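/- Let $1\le k\le n$ and let $w_1,\dots,w_n$ be positive integers with $\gcd(w_1,\dots,w_n)=1$, put $d=\sum_{i=1}^n w_i$, and assume $w_i\mid d$ for all $i$. Let $\beta_1,\dots,\beta_k$ be positive integers with $\sum_{i=1}^k\beta_iw_i=d$, and put $\gamma=\gcd(\beta_1w_1,\dots,\beta_kw_k)$. For $a\in\mathbb C$ let $X_a$ be the hypersurface in the complex weighted projective space $\mathbb P_{w_1,\dots,w_n}$ given by $$F_a=\sum_{i=1}^n x_i^{d/w_i}+a\prod_{i=1}^k x_i^{\beta_i}.$$ A point of $X_a$ is called singular if all partial derivatives $\partial F_a/\partial x_i$ vanish there, i.e. if the affine cone $\{F_a=0\}\subset\mathbb C^n$ is singular along the corresponding punctured line. (Thus the quotient singularities that $X_a$ may inherit from $\mathbb P_{w_1,\dots,w_n}$ are not counted.) The discriminant of the family is the set of all $a\in\mathbb C$ for which $X_a$ has a singular point. The local equation and the Milnor number at a singular point $p$ are those of the hypersurface $\{F_a|_{x_j=1}=0\}\subset\mathbb C^{n-1}$ at any point lying over $p$, where $x_j=1$ defines the orbifold chart over $\{x_j\neq 0\}$. Then: 1. The discriminant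 is the set of zeros $a\in\mathbb C$ of $$a^{d/\gamma}+(-1)^{d/\gamma-1}\,\frac{d^{d/\gamma}}{\prod_{i=1}^k(\beta_iw_i)^{\beta_iw_i/\gamma}},$$ and it consists of exactly $d/\gamma$ points. 2. For each $a$ in the discriminant, $X_a$ has precisely $$\frac{\gcd(w_1,\dots,w_k)}{\prod_{i=1}^k w_i}\cdot d^{\,k-2}\cdot\gamma$$ singular points (and no further ones). All of them lie in the chart $x_1\neq0$. At each of them, in every orbifold chart that contains it, $X_a$ has in suitable local holomorphic coordinates $x_2,\dots,x_n$ centred at the point the local equation $$\sum_{i=2}^k x_i^2+\sum_{i=k+1}^n x_i^{d/w_i}=0,$$ and its Milnor number is $\prod_{i=k+1}^n\left(\frac d{w_i}-1\right)$. -/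

import Mathlib

open Finset
open scoped BigOperators

noncomputable section

namespace FermatFamily

/-- Two nonzero vectors are identified when they differ by the action of some `t ∈ ℂˣ`
through `(v₁, …, vₙ) ↦ (t ^ w₁ * v₁, …, t ^ wₙ * vₙ)`. -/
def weightedSetoid {n : ℕ} (w : Fin n → ℕ) : Setoid {v : Fin n → ℂ // v ≠ 0} where
  r u v := ∃ t : ℂˣ, ∀ i, v.1 i = (t : ℂ) ^ w i * u.1 i
  iseqv :=
    { refl := fun u => ⟨1, fun i => by simp⟩
      symm := by
        rintro u v ⟨t, ht⟩
        refine ⟨t⁻¹, fun i => ?_⟩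
        rw [ht i, ← mul_assoc, ← mul_pow]
        simp
      trans := by
        rintro u v z ⟨t, ht⟩ ⟨s, hs⟩
        refine ⟨s * t, fun i => ?_⟩
        rw [hs i, ht i, Units.val_mul, mul_pow, mul_assoc] }

/-- The (closed points of the) complex weighted projective space with weights `w`. -/
def WeightedProjectiveSpace {n : ℕ} (w : Fin n → ℕ) : Type :=
  Quotient (weightedSetoid w)

/-- The point with weighted homogeneous coordinates `v`. -/
def WeightedProjectiveSpace.mk {n : ℕ} (w : Fin n → ℕ) (v : {v : Fin n → ℂ // v ≠ 0}) :
    WeightedProjectiveSpace w :=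
  Quotient.mk (weightedSetoid w) v

/-- The points of weighted projective space at which the hypersurface `F = 0` is singular:
`F` and all its partial derivatives vanish at homogeneous coordinates of the point, i.e. the
affine cone over the hypersurface is singular along the corresponding punctured line. -/
def singularPoints {n : ℕ} (w : Fin n → ℕ) (F : MvPolynomial (Fin n) ℂ) :
    Set (WeightedProjectiveSpace w) :=
  {p | ∃ v : {v : Fin n → ℂ // v ≠ 0}, WeightedProjectiveSpace.mk w v = p ∧
    MvPolynomial.eval v.1 F = 0 ∧ ∀ i, MvPolynomial.eval v.1 (MvPolynomial.pderiv i F) = 0}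

/-- The `j`-th orbifold chart `ℂᵐ → ℙ_w`, `y ↦ [y₀ : … : 1 : … : y_{m-1}]` with `1` inserted in
position `j`. It covers the affine chart `x_j ≠ 0`, which is its quotient by the group of
`w_j`-th roots of unity. -/
def orbifoldChart {m : ℕ} (w : Fin (m + 1) → ℕ) (j : Fin (m + 1)) (y : Fin m → ℂ) :
    WeightedProjectiveSpace w :=
  WeightedProjectiveSpace.mk w
    ⟨j.insertNth (α := fun _ => ℂ) 1 y, fun h => by simpa using congrFun h j⟩

/-- The equation of the hypersurface `F = 0` in the `j`-th orbifold chart: `x_j` is set to `1`. -/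
def chartEquation {m : ℕ} (F : MvPolynomial (Fin (m + 1)) ℂ) (j : Fin (m + 1)) :
    MvPolynomial (Fin m) ℂ :=
  MvPolynomial.aeval
    (j.insertNth (α := fun _ => MvPolynomial (Fin m) ℂ) 1 MvPolynomial.X) F

/-- In suitable local holomorphic coordinates centred at `y`, given by a biholomorphic map `φ`
from a neighbourhood of `0` onto a neighbourhood of `y`, the polynomial `f` becomes `g`. -/
def HasLocalEquation {m : ℕ} (f : MvPolynomial (Fin m) ℂ) (y : Fin m → ℂ)
    (g : MvPolynomial (Fin m) ℂ) : Prop :=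
  ∃ φ : OpenPartialHomeomorph (Fin m → ℂ) (Fin m → ℂ),
    0 ∈ φ.source ∧ φ 0 = y ∧
    AnalyticOnNhd ℂ φ φ.source ∧ AnalyticOnNhd ℂ φ.symm φ.target ∧
    ∀ z ∈ φ.source, MvPolynomial.eval (φ z) f = MvPolynomial.eval z g

/-- The prime (in fact maximal) ideal of the polynomials that vanish at `y`. -/
abbrev pointIdeal {m : ℕ} (y : Fin m → ℂ) : Ideal (MvPolynomial (Fin m) ℂ) :=
  RingHom.ker (MvPolynomial.eval y)

instance pointIdeal_isPrime {m : ℕ} (y : Fin m → ℂ) : (pointIdeal y).IsPrime :=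
  RingHom.ker_isPrime _

/-- The local ring of affine space `𝔸ᵐ` over `ℂ` at the point `y`. -/
abbrev LocalRingAt {m : ℕ} (y : Fin m → ℂ) : Type :=
  Localization.AtPrime (pointIdeal y)

/-- The Jacobian ideal `(∂f/∂x_1, …, ∂f/∂x_m)` in the local ring at `y`. -/
def jacobianIdeal {m : ℕ} (f : MvPolynomial (Fin m) ℂ) (y : Fin m → ℂ) :
    Ideal (LocalRingAt y) :=
  Ideal.span (Set.range fun i =>
    algebraMap (MvPolynomial (Fin m) ℂ) (LocalRingAt y) (MvPolynomial.pderiv i f))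

/-- The Milnor number of the polynomial `f` at `y`: the complex dimension of the local Milnor
algebra, with value `⊤` if this dimension is infinite. -/
def milnorNumber {m : ℕ} (f : MvPolynomial (Fin m) ℂ) (y : Fin m → ℂ) : ℕ∞ :=
  Cardinal.toENat (Module.rank ℂ (LocalRingAt y ⧸ jacobianIdeal f y))

/-- The polynomial `∑ i, x_i ^ (d / w_i) + a * ∏_{i ≤ k} x_i ^ β_i`. The variables are numbered
from `0`, so that the first `k` of them are those with index `< k`. -/
def familyPolynomial {n : ℕ} (w β : Fin n → ℕ) (k d : ℕ) (a : ℂ) : MvPolynomial (Fin n) ℂ :=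
  (∑ i, MvPolynomial.X i ^ (d / w i)) +
    MvPolynomial.C a * ∏ i with i.val < k, MvPolynomial.X i ^ β i

/-- The discriminant of the family: the parameter values whose fibre has a singular point. -/
def discriminant {n : ℕ} (w β : Fin n → ℕ) (k d : ℕ) : Set ℂ :=
  {a | (singularPoints w (familyPolynomial w β k d a)).Nonempty}

/-- The polynomial `∑_{i=2}^k x_i ^ 2 + ∑_{i=k+1}^n x_i ^ (d / w_i)` in the `m = n - 1` variables
`x_2, …, x_n`; the variable `X i` with `i : Fin m` stands for `x_{i+2}`, whose weight is
`w i.succ`. -/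
def normalForm {m : ℕ} (w : Fin (m + 1) → ℕ) (k d : ℕ) : MvPolynomial (Fin m) ℂ :=
  (∑ i with i.succ.val < k, MvPolynomial.X i ^ 2) +
    ∑ i with k ≤ i.succ.val, MvPolynomial.X i ^ (d / w i.succ)

end FermatFamily

end

/-! Let `M` be the monomial of the family. The Euler operators give `w_i x_i ∂_i F = d x_i ^ (d /
w_i) + a β_i w_i M` for the first `k` indices, without the second term for the others. Hence a
vector is singular exactly when its last coordinates vanish, its first `k` do not, and `d v_i ^ (d /
w_i) = -a β_i w_i M` for the latter (`singular_iff_isSingularVector`); `F = 0` then follows from `∑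
β_i w_i = d`.

Raising the `i`-th equation to the power `β_i w_i / γ` and multiplying eliminates `v`, which yields
the discriminant equation. Conversely, take roots of `β_i w_i` and correct `M` by roots of unity:
the character `η ↦ ∏ η_i ^ β_i` on the product of the groups of `d / w_i`-th roots of unity has
image all of the `d / γ`-th ones (`range_monomialHom`).

For fixed `a`, rescaling normalises the value of `M`, so the kernel of this character acts
transitively on the singular points, and two elements give the same point iff they differ by a
scaling by a `d`-th root of unity. The number of points is therefore an index of finite groups
(`relIndex_mul_eq`).

In a chart the equation is a polynomial in the `k - 1` remaining variables of the monomial plus a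
Fermat polynomial in the others. The first summand has nondegenerate Hessian
(`isUnit_det_hessian_chartPolynomial`). The holomorphic Morse lemma then gives the normal form, and
inverting a matrix over the local ring makes the Jacobian ideal one of pure powers, which gives the
Milnor number. -/

noncomputable section

namespace FermatFamily

/-! ### Hadamard's lemma to first and second order -/

section Hadamard

variable {σ : Type*} [Fintype σ] {R : Type*} [CommRing R]

/-- Hadamard's lemma for polynomials vanishing at a point. -/
theorem exists_eq_sum_mul_X_sub_C (p : σ → R) (g : MvPolynomial σ R)
    (hg : MvPolynomial.eval p g = 0) :
    ∃ c : σ → MvPolynomial σ R,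
      g = ∑ i, c i * (MvPolynomial.X i - MvPolynomial.C (p i)) := by
  have key : ∀ g : MvPolynomial σ R, g - MvPolynomial.C (MvPolynomial.eval p g) ∈
      Ideal.span (Set.range fun i => (MvPolynomial.X i - MvPolynomial.C (p i) :
        MvPolynomial σ R)) := by
    intro g
    induction g using MvPolynomial.induction_on with
    | C a => simp
    | add f g hf hg =>
      have := Ideal.add_mem _ hf hg
      convert this using 1
      simp only [map_add]; ring
    | mul_X f i hf =>
      have h1 := Ideal.mul_mem_right (MvPolynomial.X i) _ hf
      have h2 := Ideal.mul_mem_left (Ideal.span (Set.range fun i =>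
        (MvPolynomial.X i - MvPolynomial.C (p i) : MvPolynomial σ R)))
        (MvPolynomial.C (MvPolynomial.eval p f)) (Ideal.subset_span ⟨i, rfl⟩)
      -- `f X_i - f(p) p_i = (f - f(p)) X_i + f(p) (X_i - p_i)`.
      convert Ideal.add_mem _ h1 h2 using 1
      simp only [map_mul, MvPolynomial.eval_X]; ring
  have h := key g
  rw [hg, map_zero, sub_zero] at h
  obtain ⟨c, hc⟩ := (Submodule.mem_span_range_iff_exists_fun _).1 h
  exact ⟨c, by simpa [smul_eq_mul] using hc.symm⟩

/-- In the Leibniz rule, the terms that keep a factor `X_j - p_j` vanish at `p`. -/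
theorem eval_coeff_of_eq_sum_mul_X_sub_C {p : σ → R} {g : MvPolynomial σ R}
    {c : σ → MvPolynomial σ R}
    (hc : g = ∑ i, c i * (MvPolynomial.X i - MvPolynomial.C (p i))) (i : σ) :
    MvPolynomial.eval p (c i) = MvPolynomial.eval p (MvPolynomial.pderiv i g) := by
  classical
  rw [hc]
  simp [Derivation.leibniz, MvPolynomial.pderiv_X, Pi.single_apply,
    apply_ite (MvPolynomial.eval p)]

/-- The Hessian matrix of a polynomial at a point. -/
def hessian (g : MvPolynomial σ R) (p : σ → R) : Matrix σ σ R :=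
  Matrix.of fun i j => MvPolynomial.eval p (MvPolynomial.pderiv i (MvPolynomial.pderiv j g))

/-- A polynomial with a critical zero at `p` is a quadratic form in `x - p` whose coefficients are
a symmetric matrix of polynomials with half the Hessian as its value at `p`. -/
theorem exists_symm_matrix_of_critical (p : σ → ℂ) (g : MvPolynomial σ ℂ)
    (hg : MvPolynomial.eval p g = 0)
    (hg' : ∀ i, MvPolynomial.eval p (MvPolynomial.pderiv i g) = 0) :
    ∃ H : Matrix σ σ (MvPolynomial σ ℂ), (∀ i j, H i j = H j i) ∧
      g = ∑ i, ∑ j, H i j * (MvPolynomial.X i - MvPolynomial.C (p i)) *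
        (MvPolynomial.X j - MvPolynomial.C (p j)) ∧
      ∀ i j, MvPolynomial.eval p (H i j) = hessian g p i j / 2 := by
  classical
  obtain ⟨c, hc⟩ := exists_eq_sum_mul_X_sub_C p g hg
  have h0 : ∀ i, MvPolynomial.eval p (c i) = 0 := fun i => by
    rw [eval_coeff_of_eq_sum_mul_X_sub_C hc, hg']
  choose b hb using fun i => exists_eq_sum_mul_X_sub_C p (c i) (h0 i)
  have hgb : g = ∑ i, ∑ j, b i j * (MvPolynomial.X i - MvPolynomial.C (p i)) *
        (MvPolynomial.X j - MvPolynomial.C (p j)) := by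
    rw [hc]
    refine Finset.sum_congr rfl fun i _ => ?_
    conv_lhs => rw [hb i]
    rw [Finset.sum_mul]
    exact Finset.sum_congr rfl fun j _ => by ring
  -- A quadratic form sees only the symmetric part of its coefficient matrix.
  refine ⟨Matrix.of fun i j => MvPolynomial.C (1 / 2) * (b i j + b j i), fun i j => ?_, ?_, ?_⟩
  · simp [add_comm]
  · have hswap : g = ∑ i, ∑ j, b j i * (MvPolynomial.X i - MvPolynomial.C (p i)) *
        (MvPolynomial.X j - MvPolynomial.C (p j)) := by
      rw [hgb, Finset.sum_comm]
      exact Finset.sum_congr rfl fun i _ => Finset.sum_congr rfl fun j _ => by ring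
    have h2 : g = MvPolynomial.C (1 / 2) * (g + g) := by
      rw [← two_mul, ← mul_assoc, ← map_ofNat MvPolynomial.C, ← map_mul]
      norm_num
    rw [h2]
    nth_rewrite 1 [hgb]
    nth_rewrite 1 [hswap]
    rw [← Finset.sum_add_distrib, Finset.mul_sum]
    refine Finset.sum_congr rfl fun i _ => ?_
    rw [← Finset.sum_add_distrib, Finset.mul_sum]
    refine Finset.sum_congr rfl fun j _ => ?_
    simp only [Matrix.of_apply]
    ring
  · intro i j
    have hd : ∀ i j, MvPolynomial.eval p (b i j) =
        MvPolynomial.eval p (MvPolynomial.pderiv j (c i)) := fun i j =>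
      eval_coeff_of_eq_sum_mul_X_sub_C (hb i) j
    have : hessian g p i j = MvPolynomial.eval p (MvPolynomial.pderiv j (c i)) +
        MvPolynomial.eval p (MvPolynomial.pderiv i (c j)) := by
      simp only [hessian, Matrix.of_apply]
      conv_lhs => rw [hc]
      simp [Derivation.leibniz, MvPolynomial.pderiv_X, Pi.single_apply, Finset.sum_add_distrib,
        apply_ite, add_comm]
    simp only [Matrix.of_apply, map_mul, MvPolynomial.eval_C, map_add, hd, this]
    ring

end Hadamard

/-! ### The holomorphic Morse lemma -/

section Morse

variable {σ : Type*} [Fintype σ] [DecidableEq σ]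

/-- A symmetric complex matrix is a Gram matrix for the dot product. -/
theorem exists_transpose_mul_self_eq (H : Matrix σ σ ℂ) (hs : H.IsSymm) :
    ∃ C : Matrix σ σ ℂ, C.transpose * C = H := by
  have hsymm : (Matrix.toBilin' H).IsSymm := by
    refine ⟨fun x y => ?_⟩
    simp only [Matrix.toBilin'_apply']
    rw [Matrix.dotProduct_mulVec, ← Matrix.mulVec_transpose, hs.eq, dotProduct_comm]
  obtain ⟨v₀, hv₀⟩ := LinearMap.BilinForm.exists_orthogonal_basis (B := Matrix.toBilin' H)
    (LinearMap.BilinForm.isSymm_iff.1 hsymm)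
  have e : Fin (Module.finrank ℂ (σ → ℂ)) ≃ σ :=
    Fintype.equivOfCardEq (by simp)
  let v := v₀.reindex e
  have hv : ∀ i j, i ≠ j → v i ⬝ᵥ H.mulVec (v j) = 0 := fun i j hij => by
    have := hv₀ (show e.symm i ≠ e.symm j by simpa using hij)
    simpa [Matrix.toBilin'_apply', v, Function.onFun] using this
  let P : Matrix σ σ ℂ := Matrix.of fun i j => v j i
  have hP : IsUnit P.det := by
    have hPv : P = (Pi.basisFun ℂ σ).toMatrix v := by
      ext i j
      simp [P, Module.Basis.toMatrix_apply]
    rw [hPv, ← Module.Basis.det_apply]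
    exact (Pi.basisFun ℂ σ).isUnit_det v
  -- With square roots `s` of the diagonal values in an orthogonal basis `P`, the factor is
  -- `diagonal s * P⁻¹`.
  choose s hs' using fun i => IsAlgClosed.exists_pow_nat_eq (v i ⬝ᵥ H.mulVec (v i)) two_pos
  have hD : P.transpose * H * P = Matrix.diagonal s * Matrix.diagonal s := by
    ext i j
    have : (P.transpose * H * P) i j = v i ⬝ᵥ H.mulVec (v j) := by
      rw [Matrix.mul_assoc, Matrix.mul_apply]
      simp [dotProduct, Matrix.mulVec, P, Matrix.mul_apply]
    rw [this, Matrix.diagonal_mul_diagonal]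
    by_cases hij : i = j
    · subst hij
      simp [← hs', sq]
    · simp [hij, hv i j hij]
  refine ⟨Matrix.diagonal s * P⁻¹, ?_⟩
  rw [Matrix.transpose_mul, Matrix.diagonal_transpose, Matrix.mul_assoc,
    ← Matrix.mul_assoc (Matrix.diagonal s), ← hD, Matrix.mul_assoc, Matrix.mul_assoc,
    Matrix.mul_nonsing_inv P hP, Matrix.mul_one, ← Matrix.mul_assoc, ← Matrix.transpose_mul,
    Matrix.mul_nonsing_inv P hP, Matrix.transpose_one, Matrix.one_mul]

open scoped Matrix.Norms.Operator in
/-- Factorisation of symmetric matrices near an invertible one, depending analytically on the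
matrix. -/
theorem exists_analytic_transpose_mul_self (C : Matrix σ σ ℂ) (hC : IsUnit C.det) :
    ∃ A : Matrix σ σ ℂ → Matrix σ σ ℂ, ContDiffAt ℂ ⊤ A (C.transpose * C) ∧
      A (C.transpose * C) = C ∧
      ∀ᶠ H in nhds (C.transpose * C), H.IsSymm → (A H).transpose * A H = H := by
  let T : Matrix σ σ ℂ →L[ℂ] Matrix σ σ ℂ :=
    LinearMap.toContinuousLinearMap (Matrix.transposeLinearEquiv σ σ ℂ ℂ).toLinearMap
  -- `A ↦ Aᵀ A` takes only symmetric values, so the inverse function theorem does not apply to it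
  -- directly. Adding the skew matrix `Cᵀ A - Aᵀ C` makes the derivative at `C` equal to `A ↦ 2 Cᵀ
  -- A`, which is invertible.
  let G : Matrix σ σ ℂ → Matrix σ σ ℂ := fun A => T A * A + C.transpose * A - T A * C
  have hT : ∀ A, T A = A.transpose := fun A => rfl
  have hGs : ContDiff ℂ ⊤ G :=
    ((T.contDiff.mul contDiff_id).add (contDiff_const.mul contDiff_id)).sub
      (T.contDiff.mul contDiff_const)
  have hCT : IsUnit C.transpose.det := by rwa [Matrix.det_transpose]
  let e₀ : Matrix σ σ ℂ ≃ₗ[ℂ] Matrix σ σ ℂ :=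
    { toFun := fun A => (2 : ℂ) • (C.transpose * A)
      map_add' := fun A B => by rw [Matrix.mul_add, smul_add]
      map_smul' := fun c A => by
        rw [Matrix.mul_smul, smul_comm]; rfl
      invFun := fun A => (1 / 2 : ℂ) • (C.transpose⁻¹ * A)
      left_inv := fun A => by
        simp only [Matrix.mul_smul, smul_smul]
        rw [← Matrix.mul_assoc, Matrix.nonsing_inv_mul _ hCT]; norm_num
      right_inv := fun A => by
        simp only [Matrix.mul_smul, smul_smul]
        rw [← Matrix.mul_assoc, Matrix.mul_nonsing_inv _ hCT]; norm_num }
  let e : Matrix σ σ ℂ ≃L[ℂ] Matrix σ σ ℂ := e₀.toContinuousLinearEquiv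
  have hGd : HasFDerivAt G (e : Matrix σ σ ℂ →L[ℂ] Matrix σ σ ℂ) C := by
    have h1 := T.hasFDerivAt (x := C)
    have h2 := hasFDerivAt_id (𝕜 := ℂ) C
    have h3 := hasFDerivAt_const (𝕜 := ℂ) C.transpose C
    have h4 := hasFDerivAt_const (𝕜 := ℂ) C C
    refine (((h1.mul' h2).add (h3.mul' h2)).sub (h1.mul' h4)).congr_fderiv ?_
    ext1 A
    change C.transpose * A + A.transpose * C + (C.transpose * A + 0 * C) -
      (C.transpose * 0 + A.transpose * C) = (2 : ℂ) • (C.transpose * A)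
    rw [two_smul, Matrix.zero_mul, Matrix.mul_zero]
    abel
  have hGC : G C = C.transpose * C := by simp [G, hT]
  have hG := hGs.contDiffAt (x := C)
  refine ⟨hG.localInverse hGd (by simp), ?_, ?_, ?_⟩
  · rw [← hGC]; exact hG.to_localInverse hGd (by simp)
  · rw [← hGC]; exact hG.localInverse_apply_image hGd (by simp)
  · have h := (hG.hasStrictFDerivAt' hGd (by simp)).eventually_right_inverse
    rw [hGC] at h
    filter_upwards [h] with H hH hsym
    set A := hG.localInverse hGd (by simp) H with hA
    have h1 : A.transpose * A + C.transpose * A - A.transpose * C = H := hH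
    have h2 := congrArg Matrix.transpose h1
    simp only [Matrix.transpose_sub, Matrix.transpose_add, Matrix.transpose_mul,
      Matrix.transpose_transpose, hsym.eq] at h2
    -- For symmetric `H`, adding the equation `G A = H` to its transpose cancels the skew part.
    have h3 : (2 : ℂ) • (A.transpose * A) = (2 : ℂ) • H := by
      calc (2 : ℂ) • (A.transpose * A) = (A.transpose * A + C.transpose * A - A.transpose * C) +
            (A.transpose * A + A.transpose * C - C.transpose * A) := by rw [two_smul]; abel
        _ = (2 : ℂ) • H := by rw [h1, h2, two_smul]
    exact smul_right_injective _ two_ne_zero h3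

end Morse

theorem contDiff_eval_mvPolynomial {σ : Type*} [Fintype σ] (g : MvPolynomial σ ℂ) :
    ContDiff ℂ ⊤ fun x : σ → ℂ => MvPolynomial.eval x g := by
  induction g using MvPolynomial.induction_on with
  | C a => simpa using contDiff_const
  | add f g hf hg => simpa using hf.add hg
  | mul_X f i hf => simpa using hf.mul (contDiff_apply ℂ ℂ i)

section Morse

variable {σ : Type*} [Fintype σ] [DecidableEq σ]

open scoped Matrix.Norms.Operator in
/-- The holomorphic Morse lemma for a polynomial with a nondegenerate critical zero. -/
theorem exists_sum_sq_coordinates (p : σ → ℂ) (g : MvPolynomial σ ℂ)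
    (hg : MvPolynomial.eval p g = 0)
    (hg' : ∀ i, MvPolynomial.eval p (MvPolynomial.pderiv i g) = 0)
    (hdet : IsUnit (hessian g p).det) :
    ∃ (ψ : (σ → ℂ) → σ → ℂ) (C : Matrix σ σ ℂ), IsUnit C.det ∧ ContDiffAt ℂ ⊤ ψ p ∧ ψ p = 0 ∧
      HasFDerivAt ψ (LinearMap.toContinuousLinearMap C.mulVecLin) p ∧
      ∀ᶠ x in nhds p, MvPolynomial.eval x g = ∑ i, ψ x i ^ 2 := by
  obtain ⟨H, hHs, hHg, hHp⟩ := exists_symm_matrix_of_critical p g hg hg'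
  let Hm : (σ → ℂ) → Matrix σ σ ℂ := fun x => Matrix.of fun i j => MvPolynomial.eval x (H i j)
  have hHm : ContDiff ℂ ⊤ Hm := by
    have : Hm = fun x => ∑ i, ∑ j, MvPolynomial.eval x (H i j) • Matrix.single i j (1 : ℂ) := by
      funext x
      conv_lhs => rw [Matrix.matrix_eq_sum_single (Hm x)]
      simp [Hm]
    rw [this]
    exact ContDiff.sum fun i _ => ContDiff.sum fun j _ =>
      (contDiff_eval_mvPolynomial _).smul contDiff_const
  have hsymm : ∀ x, (Hm x).IsSymm := fun x => by
    ext i j; simp [Hm, hHs i j]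
  obtain ⟨C, hC⟩ := exists_transpose_mul_self_eq (Hm p) (hsymm p)
  have hCdet : IsUnit C.det := by
    have h1 : Hm p = (1 / 2 : ℂ) • hessian g p := by
      ext i j; simp [Hm, hHp]; ring
    have h2 : IsUnit (Hm p).det := by
      rw [h1, Matrix.det_smul]
      exact IsUnit.mul (IsUnit.pow _ (by norm_num)) hdet
    rw [← hC, Matrix.det_mul] at h2
    exact isUnit_of_mul_isUnit_right h2
  obtain ⟨A, hA, hAC, hAH⟩ := exists_analytic_transpose_mul_self C hCdet
  rw [hC] at hA hAC hAH
  let a : σ → σ → (σ → ℂ) → ℂ := fun i j x => A (Hm x) i j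
  have ha : ∀ i j, ContDiffAt ℂ ⊤ (a i j) p := fun i j =>
    (LinearMap.toContinuousLinearMap
      (Matrix.entryLinearMap ℂ ℂ i j)).contDiff.contDiffAt.comp p
      (ContDiffAt.comp p hA hHm.contDiffAt)
  -- With `Aᵀ A` equal to the coefficient matrix of `g`, the coordinates `A (x - p)` have sum of
  -- squares `g`. Since `x - p` vanishes at `p`, only the value `C` of `A` enters the derivative
  -- there.
  let ψ : (σ → ℂ) → σ → ℂ := fun x i => ∑ j, a i j x * (x j - p j)
  have hlin : ∀ j, ContDiff ℂ ⊤ fun x : σ → ℂ => x j - p j := fun j =>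
    (contDiff_apply ℂ ℂ j).sub contDiff_const
  refine ⟨ψ, C, hCdet, ?_, ?_, ?_, ?_⟩
  · exact contDiffAt_pi.2 fun i => ContDiffAt.sum fun j _ => (ha i j).mul (hlin j).contDiffAt
  · funext i; simp [ψ]
  · refine hasFDerivAt_pi'.2 fun i => ?_
    have h1 : ∀ j, HasFDerivAt (fun x : σ → ℂ => x j - p j)
        (ContinuousLinearMap.proj (R := ℂ) (φ := fun _ : σ => ℂ) j) p := fun j =>
      (hasFDerivAt_apply (𝕜 := ℂ) j p).sub_const _
    have h2 := HasFDerivAt.fun_sum fun j (_ : j ∈ Finset.univ) =>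
      (((ha i j).differentiableAt (by simp)).hasFDerivAt.mul (h1 j))
    refine h2.congr_fderiv ?_
    ext1 v
    simp [a, hAC, Matrix.mulVec, dotProduct]
  · have hev : ∀ᶠ x in nhds p, (Hm x).IsSymm → (A (Hm x)).transpose * A (Hm x) = Hm x :=
      hHm.continuous.continuousAt.eventually hAH
    filter_upwards [hev] with x hx
    have hx' := hx (hsymm x)
    have h1 : ψ x = (A (Hm x)).mulVec (fun j => x j - p j) := rfl
    have h2 : ∑ i, ψ x i ^ 2 = ψ x ⬝ᵥ ψ x := by simp [dotProduct, sq]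
    rw [h2, h1, Matrix.dotProduct_mulVec, ← Matrix.mulVec_transpose, Matrix.mulVec_mulVec, hx',
      hHg]
    simp only [map_sum, map_mul, map_sub, MvPolynomial.eval_X, MvPolynomial.eval_C, dotProduct,
      Matrix.mulVec, Finset.sum_mul, Hm, Matrix.of_apply]
    refine Finset.sum_congr rfl fun i _ => Finset.sum_congr rfl fun j _ => ?_
    rw [hHs i j]; ring

end Morse

/-! ### Local coordinates and splitting off the Fermat variables -/

/-- The inverse function theorem for a holomorphic map of a finite dimensional space, with
a property that holds near the base point imposed on the target of the inverse. -/
theorem exists_biholomorphic_of_hasFDerivAt {E : Type*} [NormedAddCommGroup E] [NormedSpace ℂ E]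
    [CompleteSpace E] {Φ : E → E} {y : E} {Φ' : E ≃L[ℂ] E}
    (hΦ : ContDiffAt ℂ ⊤ Φ y) (hΦ' : HasFDerivAt Φ (Φ' : E →L[ℂ] E) y)
    {P : E → Prop} (hP : ∀ᶠ x in nhds y, P x) :
    ∃ φ : OpenPartialHomeomorph E E, Φ y ∈ φ.source ∧ φ (Φ y) = y ∧
      AnalyticOnNhd ℂ φ φ.source ∧ AnalyticOnNhd ℂ φ.symm φ.target ∧
      ∀ z ∈ φ.source, P (φ z) ∧ Φ (φ z) = z := by
  let e := hΦ.toOpenPartialHomeomorph Φ hΦ' (by simp)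
  have hye : y ∈ e.source := hΦ.mem_toOpenPartialHomeomorph_source hΦ' (by simp)
  have heΦ : ∀ x, e x = Φ x := fun x => rfl
  have hsymm : ContDiffAt ℂ ⊤ e.symm (Φ y) := hΦ.to_localInverse hΦ' (by simp)
  have hsymm_y : e.symm (Φ y) = y := e.left_inv hye
  have h1 : ∀ᶠ x in nhds y, P x ∧ AnalyticAt ℂ Φ x :=
    hP.and (hΦ.analyticAt.eventually_analyticAt)
  have h2 : ∀ᶠ z in nhds (Φ y), AnalyticAt ℂ e.symm z := hsymm.analyticAt.eventually_analyticAt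
  have h3 : ∀ᶠ x in nhds y, AnalyticAt ℂ e.symm (Φ x) := hΦ.continuousAt.eventually h2
  obtain ⟨U, hU, hUo, hyU⟩ := eventually_nhds_iff.1 (h1.and h3)
  -- On `U` the property `P` and the analyticity of both `Φ` and its inverse hold at every point,
  -- not only at `y`.
  let r := e.restrOpen U hUo
  refine ⟨r.symm, ?_, ?_, ?_, ?_, ?_⟩
  · exact r.map_source (x := y) ⟨hye, hyU⟩
  · exact r.left_inv (x := y) ⟨hye, hyU⟩
  · intro z hz
    have hz' := r.map_target hz
    have h := (hU _ hz'.2).2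
    have h4 : Φ (r.symm z) = z := r.right_inv hz
    rw [h4] at h
    exact h
  · intro x hx
    exact (hU x hx.2).1.2
  · intro z hz
    exact ⟨(hU _ (r.map_target hz).2).1.1, r.right_inv hz⟩

/-- Splitting off the variables outside `S`, in which the polynomial is a Fermat polynomial, from
those in `S`, in which it has a nondegenerate critical zero. -/
theorem hasLocalEquation_rename_add {m : ℕ} (S : Fin m → Prop) [DecidablePred S]
    (g : MvPolynomial {i // S i} ℂ) (e : Fin m → ℕ) (y : Fin m → ℂ)
    (hy : ∀ i, ¬ S i → y i = 0)
    (hg : MvPolynomial.eval (fun i : {i // S i} => y i) g = 0)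
    (hg' : ∀ i, MvPolynomial.eval (fun i : {i // S i} => y i) (MvPolynomial.pderiv i g) = 0)
    (hdet : IsUnit (hessian g (fun i : {i // S i} => y i)).det) :
    HasLocalEquation
      (MvPolynomial.rename Subtype.val g + ∑ i with ¬ S i, MvPolynomial.X i ^ e i) y
      ((∑ i with S i, MvPolynomial.X i ^ 2) + ∑ i with ¬ S i, MvPolynomial.X i ^ e i) := by
  obtain ⟨ψ, C, hC, hψ, hψ0, hψ', hψg⟩ := exists_sum_sq_coordinates _ g hg hg' hdet
  let res : (Fin m → ℂ) →L[ℂ] ({i // S i} → ℂ) :=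
    ContinuousLinearMap.pi fun i => ContinuousLinearMap.proj i.1
  have hres : ∀ x i, res x i = x i.1 := fun x i => rfl
  -- Morse coordinates in the variables of `S`, the identity in the others; `L` is the derivative at
  -- `y`.
  let Φ : (Fin m → ℂ) → Fin m → ℂ := fun x i => if h : S i then ψ (res x) ⟨i, h⟩ else x i
  let L : (Fin m → ℂ) →ₗ[ℂ] (Fin m → ℂ) := LinearMap.pi fun i =>
    if h : S i then (LinearMap.proj ⟨i, h⟩ ∘ₗ C.mulVecLin) ∘ₗ (res : (Fin m → ℂ) →ₗ[ℂ] _)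
    else LinearMap.proj i
  have hL1 : ∀ v i (h : S i), L v i = C.mulVec (res v) ⟨i, h⟩ := fun v i h => by
    simp [L, h]
  have hL2 : ∀ v i, ¬ S i → L v i = v i := fun v i h => by simp [L, h]
  have hLinj : Function.Injective L := by
    rw [← LinearMap.ker_eq_bot, LinearMap.ker_eq_bot']
    intro v hv
    have h1 : C.mulVec (res v) = 0 := by
      funext i
      rw [← hL1 v i.1 i.2, hv]; rfl
    have h2 : res v = 0 := by
      have := congrArg (C⁻¹.mulVec) h1
      rwa [Matrix.mulVec_mulVec, Matrix.nonsing_inv_mul _ hC, Matrix.one_mulVec,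
        Matrix.mulVec_zero] at this
    funext i
    by_cases hi : S i
    · exact congrFun h2 ⟨i, hi⟩
    · rw [← hL2 v i hi, hv]
  let L' : (Fin m → ℂ) ≃L[ℂ] (Fin m → ℂ) :=
    (LinearEquiv.ofInjectiveEndo L hLinj).toContinuousLinearEquiv
  have hL' : ∀ v, L' v = L v := fun v => rfl
  have hΦc : ContDiffAt ℂ ⊤ Φ y := by
    refine contDiffAt_pi.2 fun i => ?_
    by_cases h : S i
    · simp only [Φ, h, dif_pos]
      exact (contDiff_apply ℂ ℂ (⟨i, h⟩ : {i // S i})).contDiffAt.comp y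
        (ContDiffAt.comp y hψ res.contDiff.contDiffAt)
    · simp only [Φ, h, dif_neg, not_false_iff]
      exact (contDiff_apply ℂ ℂ i).contDiffAt
  have hΦd : HasFDerivAt Φ (L' : (Fin m → ℂ) →L[ℂ] (Fin m → ℂ)) y := by
    refine hasFDerivAt_pi'.2 fun i => ?_
    by_cases h : S i
    · simp only [Φ, h, dif_pos]
      have h1 := HasFDerivAt.comp y (show HasFDerivAt ψ _ (res y) from hψ') res.hasFDerivAt
      refine ((hasFDerivAt_pi'.1 h1) ⟨i, h⟩).congr_fderiv ?_
      ext1 v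
      exact (hL1 v i h).symm
    · simp only [Φ, h, dif_neg, not_false_iff]
      refine (hasFDerivAt_apply (𝕜 := ℂ) i y).congr_fderiv ?_
      ext1 v
      exact (hL2 v i h).symm
  have hΦy : Φ y = 0 := by
    funext i
    by_cases h : S i
    · simp only [Φ, h, dif_pos]
      exact congrFun hψ0 ⟨i, h⟩
    · simp [Φ, h, hy i h]
  have hP : ∀ᶠ x in nhds y, MvPolynomial.eval (res x) g = ∑ i, ψ (res x) i ^ 2 :=
    (res.continuous.continuousAt (x := y)).eventually hψg
  obtain ⟨φ, h0, hφ0, ha, hb, hφ⟩ := exists_biholomorphic_of_hasFDerivAt hΦc hΦd hP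
  rw [hΦy] at h0 hφ0
  refine ⟨φ, h0, hφ0, ha, hb, fun z hz => ?_⟩
  obtain ⟨h1, h2⟩ := hφ z hz
  have h3 : ∀ i (h : S i), z i = ψ (res (φ z)) ⟨i, h⟩ := fun i h => by
    conv_lhs => rw [← h2]
    simp [Φ, h]
  have h4 : ∀ i, ¬ S i → z i = φ z i := fun i h => by
    conv_lhs => rw [← h2]
    simp [Φ, h]
  simp only [map_add, map_sum, map_pow, MvPolynomial.eval_X, MvPolynomial.eval_rename]
  congr 1
  · rw [show (φ z ∘ Subtype.val : {i // S i} → ℂ) = res (φ z) from rfl, h1,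
      Finset.sum_subtype (Finset.univ.filter S) (p := S) (by simp)]
    exact Finset.sum_congr rfl fun i _ => by rw [h3 i.1 i.2]
  · refine Finset.sum_congr rfl fun i hi => ?_
    rw [h4 i (Finset.mem_filter.1 hi).2]

/-! ### Local algebras and Milnor numbers -/

section Milnor

/-- Localising at a maximal ideal does not change the quotient by an ideal which contains one of
its powers. -/
theorem surjective_and_ker_quotient_localization {k A L : Type*} [Field k] [CommRing A]
    [Algebra k A] [CommRing L] [Algebra k L] [Algebra A L] [IsScalarTower k A L]
    (p : Ideal A) [p.IsMaximal] [IsLocalization.AtPrime L p] (I : Ideal A) (N : ℕ)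
    (hI : p ^ N ≤ I) :
    Function.Surjective ((Ideal.Quotient.mkₐ k (I.map (algebraMap A L))).comp
      (IsScalarTower.toAlgHom k A L)) ∧
    ∀ x, ((Ideal.Quotient.mkₐ k (I.map (algebraMap A L))).comp
      (IsScalarTower.toAlgHom k A L)) x = 0 ↔ x ∈ I := by
  -- Elements outside `p` are already units modulo `p ^ N`, hence modulo `I`, so localising inverts
  -- nothing new in the quotient.
  have hunit : ∀ s : A, s ∉ p → ∃ t, t * s - 1 ∈ I := fun s hs => by
    obtain ⟨u, hu⟩ := (Ideal.Quotient.isUnit_mk_pow_of_notMem (n := N) p hs).exists_left_inv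
    obtain ⟨t, rfl⟩ := Ideal.Quotient.mk_surjective u
    refine ⟨t, hI ?_⟩
    rw [← Ideal.Quotient.eq_zero_iff_mem]
    simp [hu]
  constructor
  · intro q
    obtain ⟨q, rfl⟩ := Ideal.Quotient.mk_surjective q
    obtain ⟨x, s, rfl⟩ := IsLocalization.exists_mk'_eq p.primeCompl q
    obtain ⟨t, ht⟩ := hunit s s.2
    refine ⟨t * x, ?_⟩
    change Ideal.Quotient.mk _ (algebraMap A L (t * x)) = _
    rw [Ideal.Quotient.eq]
    have h1 : algebraMap A L (t * x) - IsLocalization.mk' L x s =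
        IsLocalization.mk' L x s * algebraMap A L (t * s - 1) := by
      rw [map_sub, map_mul, map_mul, map_one]
      nth_rewrite 1 [← IsLocalization.mk'_spec L x s]
      ring
    rw [h1]
    exact Ideal.mul_mem_left _ _ (Ideal.mem_map_of_mem _ ht)
  · intro x
    change Ideal.Quotient.mk _ (algebraMap A L x) = 0 ↔ _
    rw [Ideal.Quotient.eq_zero_iff_mem,
      IsLocalization.algebraMap_mem_map_algebraMap_iff p.primeCompl L]
    constructor
    · rintro ⟨s, hs, h⟩
      obtain ⟨t, ht⟩ := hunit s hs
      have h1 := Ideal.sub_mem _ (Ideal.mul_mem_left I t h) (Ideal.mul_mem_right x I ht)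
      convert h1 using 1
      ring
    · intro h
      exact ⟨1, Submonoid.one_mem _, by simpa using h⟩

variable {m : ℕ}

/-- The coefficients of the monomials with exponents below `c` in the expansion at `y`. -/
def truncatedTaylor (y : Fin m → ℂ) (c : Fin m → ℕ) :
    MvPolynomial (Fin m) ℂ →ₗ[ℂ] ((∀ i, Fin (c i)) → ℂ) :=
  LinearMap.pi fun s => MvPolynomial.lcoeff ℂ (Finsupp.equivFunOnFinite.symm fun i => (s i : ℕ)) ∘ₗ
    (MvPolynomial.aeval fun i => MvPolynomial.X i + MvPolynomial.C (y i) :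
      MvPolynomial (Fin m) ℂ →ₐ[ℂ] MvPolynomial (Fin m) ℂ).toLinearMap

/-- For a monomial ideal, membership is read off the support; the monomials outside this one are
those with all exponents below `c`. -/
theorem mem_span_X_pow_iff (c : Fin m → ℕ) (P : MvPolynomial (Fin m) ℂ) :
    P ∈ Ideal.span (Set.range fun i => (MvPolynomial.X i : MvPolynomial (Fin m) ℂ) ^ c i) ↔
      ∀ s : ∀ i, Fin (c i),
        P.coeff (Finsupp.equivFunOnFinite.symm fun i => (s i : ℕ)) = 0 := by
  have h : (Set.range fun i => (MvPolynomial.X i : MvPolynomial (Fin m) ℂ) ^ c i) =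
      (fun s => MvPolynomial.monomial s (1 : ℂ)) '' Set.range fun i => Finsupp.single i (c i) := by
    rw [← Set.range_comp]
    congr 1
    funext i
    simp [MvPolynomial.X_pow_eq_monomial]
  rw [h, MvPolynomial.mem_ideal_span_monomial_image]
  simp only [Set.exists_range_iff, Finsupp.single_le_iff, MvPolynomial.mem_support_iff]
  constructor
  · intro h s
    by_contra hs
    obtain ⟨i, hi⟩ := h _ hs
    exact absurd (s i).2 (not_lt.2 (by simpa using hi))
  · intro h x hx
    by_contra! hlt
    refine hx ?_
    rw [← h fun i => ⟨x i, hlt i⟩]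
    congr 1
    ext i
    rfl

theorem truncatedTaylor_surjective (y : Fin m → ℂ) (c : Fin m → ℕ) :
    Function.Surjective (truncatedTaylor y c) := by
  intro v
  refine ⟨MvPolynomial.aeval (fun i => MvPolynomial.X i - MvPolynomial.C (y i))
    (∑ s : ∀ i, Fin (c i), MvPolynomial.monomial
      (Finsupp.equivFunOnFinite.symm fun i => (s i : ℕ)) (v s)), ?_⟩
  funext t
  simp only [truncatedTaylor, LinearMap.pi_apply, LinearMap.comp_apply, AlgHom.toLinearMap_apply]
  rw [← AlgHom.comp_apply]
  have : ((MvPolynomial.aeval fun i => MvPolynomial.X i + MvPolynomial.C (y i) :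
      MvPolynomial (Fin m) ℂ →ₐ[ℂ] MvPolynomial (Fin m) ℂ)).comp
      (MvPolynomial.aeval fun i => MvPolynomial.X i - MvPolynomial.C (y i)) =
      AlgHom.id ℂ _ := by
    ext1 i
    simp [MvPolynomial.algHom_C]
  rw [this]
  simp only [AlgHom.id_apply, MvPolynomial.lcoeff_apply, MvPolynomial.coeff_sum,
    MvPolynomial.coeff_monomial]
  rw [Finset.sum_eq_single t]
  · simp
  · intro s _ hs
    rw [if_neg]
    intro h
    refine hs (funext fun i => Fin.ext ?_)
    exact congrFun (Finsupp.equivFunOnFinite.symm.injective h) i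
  · simp

/-- The ideal generated by the powers `(x_i - y_i) ^ c_i`. -/
def powerIdeal (y : Fin m → ℂ) (c : Fin m → ℕ) : Ideal (MvPolynomial (Fin m) ℂ) :=
  Ideal.span (Set.range fun i => (MvPolynomial.X i - MvPolynomial.C (y i)) ^ c i)

/-- Translation by `y` is an automorphism that carries `powerIdeal y c` to the monomial ideal at the
origin. -/
theorem truncatedTaylor_eq_zero_iff (y : Fin m → ℂ) (c : Fin m → ℕ)
    (P : MvPolynomial (Fin m) ℂ) : truncatedTaylor y c P = 0 ↔ P ∈ powerIdeal y c := by
  let τ : MvPolynomial (Fin m) ℂ →ₐ[ℂ] MvPolynomial (Fin m) ℂ :=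
    MvPolynomial.aeval fun i => MvPolynomial.X i + MvPolynomial.C (y i)
  let τ' : MvPolynomial (Fin m) ℂ →ₐ[ℂ] MvPolynomial (Fin m) ℂ :=
    MvPolynomial.aeval fun i => MvPolynomial.X i - MvPolynomial.C (y i)
  have hτ : τ'.comp τ = AlgHom.id ℂ _ := by
    ext1 i
    simp [τ, τ', MvPolynomial.algHom_C]
  have h1 : truncatedTaylor y c P = 0 ↔ τ P ∈ Ideal.span
      (Set.range fun i => (MvPolynomial.X i : MvPolynomial (Fin m) ℂ) ^ c i) := by
    rw [mem_span_X_pow_iff, funext_iff]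
    rfl
  rw [h1]
  constructor
  · intro h
    have := Ideal.mem_map_of_mem τ' h
    rw [← AlgHom.comp_apply, hτ, Ideal.map_span, ← Set.range_comp] at this
    have hX : (τ' ∘ fun i => (MvPolynomial.X i : MvPolynomial (Fin m) ℂ) ^ c i) =
        fun i => (MvPolynomial.X i - MvPolynomial.C (y i)) ^ c i := by
      funext i
      simp [τ']
    rwa [hX] at this
  · intro h
    have := Ideal.mem_map_of_mem τ h
    rw [powerIdeal, Ideal.map_span, ← Set.range_comp] at this
    have hX : (τ ∘ fun i => (MvPolynomial.X i - MvPolynomial.C (y i)) ^ c i) =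
        fun i => (MvPolynomial.X i : MvPolynomial (Fin m) ℂ) ^ c i := by
      funext i
      simp [τ, MvPolynomial.algHom_C]
    rwa [hX] at this

/-- Each generator `X_i - y_i` lies in the radical of the power ideal, and the ring is Noetherian.
-/
theorem exists_pointIdeal_pow_le_powerIdeal (y : Fin m → ℂ) (c : Fin m → ℕ) :
    ∃ N, pointIdeal y ^ N ≤ powerIdeal y c := by
  refine Ideal.exists_pow_le_of_le_radical_of_fg ?_ (IsNoetherian.noetherian _)
  intro P hP
  obtain ⟨b, rfl⟩ := exists_eq_sum_mul_X_sub_C y P hP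
  exact Ideal.sum_mem _ fun i _ => Ideal.mul_mem_left _ _ ⟨c i, Ideal.subset_span ⟨i, rfl⟩⟩

/-- The map to the local quotient and the truncated Taylor expansion are surjections with the same
kernel, so their targets have the same dimension. -/
theorem milnorNumber_eq_of_jacobianIdeal_eq (f : MvPolynomial (Fin m) ℂ) (y : Fin m → ℂ)
    (c : Fin m → ℕ)
    (h : jacobianIdeal f y =
      (powerIdeal y c).map (algebraMap (MvPolynomial (Fin m) ℂ) (LocalRingAt y))) :
    milnorNumber f y = ((∏ i, c i : ℕ) : ℕ∞) := by
  have hmax : (pointIdeal y).IsMaximal :=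
    RingHom.ker_isMaximal_of_surjective _ fun a => ⟨MvPolynomial.C a, by simp⟩
  obtain ⟨N, hN⟩ := exists_pointIdeal_pow_le_powerIdeal y c
  obtain ⟨h1, h2⟩ := surjective_and_ker_quotient_localization (k := ℂ) (L := LocalRingAt y)
    (pointIdeal y) (powerIdeal y c) N hN
  rw [milnorNumber, h]
  have hker : LinearMap.ker ((Ideal.Quotient.mkₐ ℂ ((powerIdeal y c).map
      (algebraMap (MvPolynomial (Fin m) ℂ) (LocalRingAt y)))).comp
      (IsScalarTower.toAlgHom ℂ _ _)).toLinearMap = LinearMap.ker (truncatedTaylor y c) := by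
    ext P
    rw [LinearMap.mem_ker, LinearMap.mem_ker, truncatedTaylor_eq_zero_iff]
    exact h2 P
  have E := ((LinearMap.quotKerEquivOfSurjective _ h1).symm.trans
    (Submodule.quotEquivOfEq _ _ hker)).trans
    (LinearMap.quotKerEquivOfSurjective _ (truncatedTaylor_surjective y c))
  rw [E.rank_eq, rank_fun']
  simp

/-- The Milnor number of a Fermat polynomial in the variables outside `S` plus a polynomial with a
nondegenerate critical point in the variables in `S`. -/
theorem milnorNumber_rename_add (S : Fin m → Prop) [DecidablePred S]
    (g : MvPolynomial {i // S i} ℂ) (e : Fin m → ℕ) (y : Fin m → ℂ)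
    (he : ∀ i, ¬ S i → e i ≠ 0) (hy : ∀ i, ¬ S i → y i = 0)
    (hg' : ∀ i, MvPolynomial.eval (fun i : {i // S i} => y i) (MvPolynomial.pderiv i g) = 0)
    (hdet : IsUnit (hessian g (fun i : {i // S i} => y i)).det) :
    milnorNumber
      (MvPolynomial.rename Subtype.val g + ∑ i with ¬ S i, MvPolynomial.X i ^ e i) y =
      ((∏ i, if S i then 1 else e i - 1 : ℕ) : ℕ∞) := by
  set f : MvPolynomial (Fin m) ℂ :=
    MvPolynomial.rename Subtype.val g + ∑ i with ¬ S i, MvPolynomial.X i ^ e i with hf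
  have hf1 : ∀ i : {i // S i}, MvPolynomial.pderiv i.1 f =
      MvPolynomial.rename Subtype.val (MvPolynomial.pderiv i g) := by
    intro i
    rw [hf, map_add, MvPolynomial.pderiv_rename Subtype.val_injective, map_sum,
      Finset.sum_eq_zero, add_zero]
    intro j hj
    have hij : j ≠ i.1 := fun h => (Finset.mem_filter.1 hj).2 (h ▸ i.2)
    simp [MvPolynomial.pderiv_X_of_ne hij]
  have hf2 : ∀ i, ¬ S i → MvPolynomial.pderiv i f =
      MvPolynomial.C (e i : ℂ) * MvPolynomial.X i ^ (e i - 1) := by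
    intro i hi
    rw [hf, map_add, MvPolynomial.pderiv_eq_zero_of_notMem_vars, zero_add, map_sum,
      Finset.sum_eq_single i]
    · simp
    · intro j _ hj
      simp [MvPolynomial.pderiv_X_of_ne hj]
    · intro h; simp [hi] at h
    · intro h
      have := MvPolynomial.vars_rename Subtype.val g h
      obtain ⟨j, _, rfl⟩ := Finset.mem_image.1 this
      exact hi j.2
  refine milnorNumber_eq_of_jacobianIdeal_eq f y _ ?_
  set al := algebraMap (MvPolynomial (Fin m) ℂ) (LocalRingAt y) with hal
  choose b hb using fun i => exists_eq_sum_mul_X_sub_C _ _ (hg' i)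
  have hbe := fun i j => eval_coeff_of_eq_sum_mul_X_sub_C (hb i) j
  let ρ : MvPolynomial {i // S i} ℂ →+* MvPolynomial (Fin m) ℂ :=
    (MvPolynomial.rename (R := ℂ) (Subtype.val : {i // S i} → Fin m)).toRingHom
  -- `M` expresses the partials in `S` through the `X_j - y_j`. Its determinant has the Hessian
  -- determinant as value at `y`, so `M` is invertible over the local ring and both families
  -- generate the same ideal.
  let M : Matrix {i // S i} {i // S i} (LocalRingAt y) :=
    (al.comp ρ).mapMatrix (Matrix.of b)
  have hM : IsUnit M.det := by
    rw [← RingHom.map_det]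
    refine IsLocalization.map_units (LocalRingAt y)
      (⟨ρ (Matrix.of b).det, ?_⟩ : (pointIdeal y).primeCompl)
    change ¬ (MvPolynomial.eval y (MvPolynomial.rename Subtype.val (Matrix.of b).det) = 0)
    rw [MvPolynomial.eval_rename, RingHom.map_det]
    have : (MvPolynomial.eval (y ∘ Subtype.val)).mapMatrix (Matrix.of b) =
        (hessian g (fun i : {i // S i} => y i)).transpose := by
      ext i j
      exact hbe i j
    rw [this, Matrix.det_transpose]
    exact hdet.ne_zero
  have hvec : M.mulVec (fun j => al (MvPolynomial.X j.1 - MvPolynomial.C (y j.1))) =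
      fun i => al (MvPolynomial.pderiv i.1 f) := by
    funext i
    rw [hf1]
    conv_rhs => rw [hb i]
    simp [M, ρ, Matrix.mulVec, dotProduct]
  rw [powerIdeal, Ideal.map_span, ← Set.range_comp]
  apply le_antisymm
  · refine Ideal.span_le.2 ?_
    rintro _ ⟨i, rfl⟩
    by_cases hi : S i
    · have := congrFun hvec ⟨i, hi⟩
      simp only at this
      simp only [SetLike.mem_coe]
      rw [Function.comp_def, ← this, Matrix.mulVec, dotProduct]
      refine Ideal.sum_mem _ fun (j : {i // S i}) _ =>
        Ideal.mul_mem_left _ _ (Ideal.subset_span ⟨j.1, ?_⟩)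
      simp [j.2]
    · simp only [SetLike.mem_coe]
      rw [hf2 i hi, map_mul]
      refine Ideal.mul_mem_left _ _ (Ideal.subset_span ⟨i, ?_⟩)
      simp [hi, hy i hi, hal]
  · refine Ideal.span_le.2 ?_
    have hJ : ∀ i, al (MvPolynomial.pderiv i f) ∈ jacobianIdeal f y := fun i =>
      Ideal.subset_span ⟨i, rfl⟩
    rintro _ ⟨i, rfl⟩
    by_cases hi : S i
    · have h1 := congrArg (M⁻¹.mulVec) hvec
      rw [Matrix.mulVec_mulVec, Matrix.nonsing_inv_mul _ hM, Matrix.one_mulVec] at h1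
      have h2 := congrFun h1 ⟨i, hi⟩
      simp only [Function.comp, hi, if_true, pow_one, SetLike.mem_coe]
      simp only at h2
      rw [h2, Matrix.mulVec, dotProduct]
      exact Ideal.sum_mem _ fun (j : {i // S i}) _ => Ideal.mul_mem_left _ _ (hJ j.1)
    · have h1 := Ideal.mul_mem_left _ (al (MvPolynomial.C (e i : ℂ)⁻¹)) (hJ i)
      rw [hf2 i hi, ← map_mul, ← mul_assoc, ← map_mul,
        inv_mul_cancel₀ (Nat.cast_ne_zero.2 (he i hi)), map_one, one_mul] at h1
      simpa [hi, hy i hi, Function.comp] using h1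

end Milnor

/-! ### Bézout relations and characters of products of groups of roots of unity -/

theorem exists_natCast_gcd_eq_sum_mul {ι : Type*} (s : Finset ι) (f : ι → ℕ) :
    ∃ c : ι → ℤ, ((s.gcd f : ℕ) : ℤ) = ∑ i ∈ s, (f i : ℤ) * c i := by
  classical
  induction s using Finset.induction with
  | empty => exact ⟨0, by simp⟩
  | insert i s hi ih =>
    obtain ⟨c, hc⟩ := ih
    refine ⟨Function.update (fun j => c j * Nat.gcdB (f i) (s.gcd f)) i
      (Nat.gcdA (f i) (s.gcd f)), ?_⟩
    rw [Finset.gcd_insert, Finset.sum_insert hi, Function.update_self]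
    change ((Nat.gcd (f i) (s.gcd f) : ℕ) : ℤ) = _
    rw [Nat.gcd_eq_gcd_ab, hc, Finset.sum_mul]
    congr 1
    refine Finset.sum_congr rfl fun j hj => ?_
    rw [Function.update_of_ne (ne_of_mem_of_not_mem hj hi), mul_assoc]

theorem prod_zpow_eq_zpow_sum {ι G : Type*} [CommGroup G] (s : Finset ι) (f : ι → ℤ) (g : G) :
    ∏ i ∈ s, g ^ f i = g ^ ∑ i ∈ s, f i := by
  classical
  induction s using Finset.induction with
  | empty => simp
  | insert i s hi ih => rw [Finset.prod_insert hi, Finset.sum_insert hi, zpow_add, ih]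

section RootsOfUnity

theorem natCard_rootsOfUnity {n : ℕ} (hn : n ≠ 0) : Nat.card (rootsOfUnity n ℂ) = n := by
  have : NeZero n := ⟨hn⟩
  exact (Complex.isPrimitiveRoot_exp n hn).card_rootsOfUnity

variable {ι : Type*} [Fintype ι] (w b e : ι → ℕ) (d : ℕ)

/-- The character `η ↦ ∏ i, η i ^ b i` of a product of groups of roots of unity. -/
def monomialHom : (∀ i, rootsOfUnity (e i) ℂ) →* ℂˣ where
  toFun η := ∏ i, (η i : ℂˣ) ^ b i
  map_one' := by simp
  map_mul' η θ := by simp [mul_pow, Finset.prod_mul_distrib]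

/-- The action of the `d`-th roots of unity by weighted scaling. -/
def scalingHom (h : ∀ i, e i * w i = d) :
    rootsOfUnity d ℂ →* (∀ i, rootsOfUnity (e i) ℂ) where
  toFun t i := ⟨(t : ℂˣ) ^ w i, by
    rw [mem_rootsOfUnity, ← pow_mul, mul_comm, h i]; exact t.2⟩
  map_one' := by ext; simp
  map_mul' s t := by ext; simp [mul_pow]

/-- Put `N = d / γ`. As `e i ∣ b i * N`, every factor of a value is killed by `N`. For the other
inclusion, write `γ = ∑ b_i w_i c_i` by Bézout: for a primitive `d`-th root `ζ`, the tuple `ζ ^ (w_i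
c_i)` maps to `ζ ^ γ`, a generator. -/
theorem range_monomialHom (hd : d ≠ 0) (h : ∀ i, e i * w i = d)
    (hγ : Finset.univ.gcd (fun i => b i * w i) ∣ d) :
    (monomialHom b e).range =
      rootsOfUnity (d / Finset.univ.gcd (fun i => b i * w i)) ℂ := by
  set γ := Finset.univ.gcd (fun i => b i * w i) with hγdef
  obtain ⟨N, hN⟩ := hγ
  have hγ0 : γ ≠ 0 := fun h0 => hd (by rw [hN, h0, zero_mul])
  have hN0 : N ≠ 0 := fun h0 => hd (by rw [hN, h0, mul_zero])
  have hdN : d / γ = N := by rw [hN, Nat.mul_div_cancel_left _ (Nat.pos_of_ne_zero hγ0)]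
  rw [hdN]
  apply le_antisymm
  · rintro _ ⟨η, rfl⟩
    rw [mem_rootsOfUnity]
    change (∏ i, (η i : ℂˣ) ^ b i) ^ N = 1
    rw [← Finset.prod_pow]
    refine Finset.prod_eq_one fun i _ => ?_
    have hdvd : e i ∣ b i * N := by
      obtain ⟨c, hc⟩ : γ ∣ b i * w i := Finset.gcd_dvd (Finset.mem_univ i)
      have hwi : 0 < w i := Nat.pos_of_ne_zero fun h0 => hd (by rw [← h i, h0, mul_zero])
      refine ⟨c, Nat.eq_of_mul_eq_mul_right hwi ?_⟩
      calc b i * N * w i = (b i * w i) * N := by ring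
        _ = c * d := by rw [hc, hN]; ring
        _ = e i * c * w i := by rw [← h i]; ring
    obtain ⟨c, hc⟩ := hdvd
    rw [← pow_mul, hc, pow_mul, (mem_rootsOfUnity _ _).1 (η i).2, one_pow]
  · obtain ⟨c, hc⟩ := exists_natCast_gcd_eq_sum_mul Finset.univ (fun i => b i * w i)
    have hζ := (Complex.isPrimitiveRoot_exp d hd).isUnit_unit hd
    set ζ : ℂˣ := ((Complex.isPrimitiveRoot_exp d hd).isUnit hd).unit
    have hζγ : IsPrimitiveRoot (ζ ^ γ) N := hζ.pow (Nat.pos_of_ne_zero hd) hN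
    have : NeZero N := ⟨hN0⟩
    rw [← hζγ.zpowers_eq, Subgroup.zpowers_le]
    refine ⟨fun i => ⟨ζ ^ ((w i : ℤ) * c i), ?_⟩, ?_⟩
    · rw [mem_rootsOfUnity, ← zpow_natCast, ← zpow_mul,
        show (w i : ℤ) * c i * (e i : ℤ) = (d : ℤ) * c i by rw [← h i]; push_cast; ring,
        zpow_mul, zpow_natCast, hζ.pow_eq_one, one_zpow]
    · change ∏ i, (ζ ^ ((w i : ℤ) * c i)) ^ b i = ζ ^ γ
      rw [← zpow_natCast ζ γ, hγdef, hc, ← prod_zpow_eq_zpow_sum]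
      refine Finset.prod_congr rfl fun i _ => ?_
      rw [← zpow_natCast, ← zpow_mul]
      congr 1
      push_cast
      ring

theorem card_ker_monomialHom_mul (hd : d ≠ 0) (h : ∀ i, e i * w i = d)
    (hγ : Finset.univ.gcd (fun i => b i * w i) ∣ d) :
    Nat.card (monomialHom b e).ker * (d / Finset.univ.gcd (fun i => b i * w i)) = ∏ i, e i := by
  have he : ∀ i, e i ≠ 0 := fun i h0 => hd (by rw [← h i, h0, zero_mul])
  have hN : d / Finset.univ.gcd (fun i => b i * w i) ≠ 0 :=
    (Nat.div_pos (Nat.le_of_dvd (Nat.pos_of_ne_zero hd) hγ)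
      (Nat.pos_of_dvd_of_pos hγ (Nat.pos_of_ne_zero hd))).ne'
  have h1 := Subgroup.card_mul_index (monomialHom b e).ker
  rw [Subgroup.index_ker, range_monomialHom w b e d hd h hγ, natCard_rootsOfUnity hN,
    Nat.card_pi] at h1
  rw [h1]
  exact Finset.prod_congr rfl fun i _ => natCard_rootsOfUnity (he i)

/-- A root of unity scales trivially iff its order divides every weight, so the kernel is the group
of `gcd w`-th roots of unity. -/
theorem gcd_mul_card_range_scalingHom (hd : d ≠ 0) (h : ∀ i, e i * w i = d)
    (hg : Finset.univ.gcd w ∣ d) :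
    Finset.univ.gcd w * Nat.card (scalingHom w e d h).range = d := by
  have hg0 : Finset.univ.gcd w ≠ 0 := fun h0 => hd (by simpa [h0] using hg)
  have h1 := Subgroup.card_mul_index (scalingHom w e d h).ker
  rw [Subgroup.index_ker, natCard_rootsOfUnity hd] at h1
  have hker : (scalingHom w e d h).ker =
      (rootsOfUnity (Finset.univ.gcd w) ℂ).subgroupOf (rootsOfUnity d ℂ) := by
    ext t
    rw [MonoidHom.mem_ker, Subgroup.mem_subgroupOf, mem_rootsOfUnity, funext_iff,
      ← orderOf_dvd_iff_pow_eq_one, Finset.dvd_gcd_iff]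
    refine ⟨fun ht i _ => orderOf_dvd_iff_pow_eq_one.2 ?_, fun ht i => ?_⟩
    · exact congrArg Subtype.val (ht i)
    · exact Subtype.ext (orderOf_dvd_iff_pow_eq_one.1 (ht i (Finset.mem_univ i)))
  have hle : rootsOfUnity (Finset.univ.gcd w) ℂ ≤ rootsOfUnity d ℂ := rootsOfUnity_le_of_dvd hg
  rwa [hker, Nat.card_congr (Subgroup.subgroupOfEquivOfLe hle).toEquiv,
    natCard_rootsOfUnity hg0] at h1

theorem range_scalingHom_le_ker (h : ∀ i, e i * w i = d) (hd : d ∣ ∑ i, b i * w i) :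
    (scalingHom w e d h).range ≤ (monomialHom b e).ker := by
  rintro _ ⟨t, rfl⟩
  rw [MonoidHom.mem_ker]
  change ∏ i, ((t : ℂˣ) ^ w i) ^ b i = 1
  obtain ⟨c, hc⟩ := hd
  rw [Finset.prod_congr rfl fun i _ => show ((t : ℂˣ) ^ w i) ^ b i = (t : ℂˣ) ^ (b i * w i) by
    rw [← pow_mul, mul_comm], Finset.prod_pow_eq_pow_sum, hc, pow_mul,
    (mem_rootsOfUnity _ _).1 t.2, one_pow]

/-- The number of orbits of the weighted scaling action on the kernel of a monomial character. -/
theorem relIndex_mul_eq (hd : d ≠ 0) (h : ∀ i, e i * w i = d)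
    (hg : Finset.univ.gcd w ∣ d) (hb : ∑ i, b i * w i = d) :
    (((scalingHom w e d h).range.relIndex (monomialHom b e).ker : ℕ) : ℚ) =
      ((Finset.univ.gcd w : ℕ) : ℚ) / (∏ i, (w i : ℚ)) * (d : ℚ) ^ ((Fintype.card ι : ℤ) - 2) *
        ((Finset.univ.gcd fun i => b i * w i : ℕ) : ℚ) := by
  have hγ : Finset.univ.gcd (fun i => b i * w i) ∣ d := by
    conv_rhs => rw [← hb]
    exact Finset.dvd_sum fun i hi => Finset.gcd_dvd hi
  have h1 := card_ker_monomialHom_mul w b e d hd h hγ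
  have h2 := gcd_mul_card_range_scalingHom w e d hd h hg
  have h3 := Subgroup.relIndex_mul_relIndex ⊥ (scalingHom w e d h).range (monomialHom b e).ker
    bot_le (range_scalingHom_le_ker w b e d h hb.symm.dvd)
  rw [Subgroup.relIndex_bot_left, Subgroup.relIndex_bot_left] at h3
  set γ := Finset.univ.gcd (fun i => b i * w i)
  set g := Finset.univ.gcd w
  set c := (scalingHom w e d h).range.relIndex (monomialHom b e).ker
  have h4 : γ * (d / γ) = d := Nat.mul_div_cancel' hγ
  have h5 : (∏ i, e i) * ∏ i, w i = d ^ Fintype.card ι := by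
    rw [← Finset.prod_mul_distrib, Finset.prod_congr rfl fun i _ => h i]
    simp
  -- The orders of kernel, range and full product are combined without division; the factor `d ^ 2`
  -- comes from `g * |range| = d` and `γ * (d / γ) = d`.
  have h6 : c * d ^ 2 * ∏ i, w i = g * γ * d ^ Fintype.card ι := by
    rw [← h5, ← h1, ← h3]
    calc c * d ^ 2 * ∏ i, w i = c * (d * d) * ∏ i, w i := by ring
      _ = c * ((g * Nat.card (scalingHom w e d h).range) * (γ * (d / γ))) * ∏ i, w i := by
        rw [h2, h4]
      _ = _ := by ring
  have hd' : (d : ℚ) ≠ 0 := Nat.cast_ne_zero.2 hd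
  have hw' : ∏ i, (w i : ℚ) ≠ 0 := Finset.prod_ne_zero_iff.2 fun i _ =>
    Nat.cast_ne_zero.2 fun h0 => hd (by rw [← h i, h0, mul_zero])
  have h7 : (c : ℚ) * d ^ 2 * ∏ i, (w i : ℚ) = g * γ * d ^ Fintype.card ι := by exact_mod_cast h6
  -- The exponent is an integer: it is `-1` when there is only one variable.
  rw [zpow_sub₀ hd', zpow_natCast, show ((d : ℚ) ^ (2 : ℤ)) = (d : ℚ) ^ 2 from zpow_ofNat _ _]
  field_simp
  linear_combination h7

end RootsOfUnity

theorem ncard_setOf_pow_eq {n : ℕ} (hn : n ≠ 0) {c : ℂ} (hc : c ≠ 0) :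
    {a : ℂ | a ^ n = c}.ncard = n := by
  classical
  have hζ := Complex.isPrimitiveRoot_exp n hn
  have h : {a : ℂ | a ^ n = c} = ((Polynomial.nthRoots n c).toFinset : Set ℂ) := by
    ext a
    simp [Polynomial.mem_nthRoots (Nat.pos_of_ne_zero hn)]
  rw [h, Set.ncard_coe_finset, Multiset.toFinset_card_of_nodup (hζ.nthRoots_nodup hc),
    hζ.card_nthRoots, if_pos (IsAlgClosed.exists_pow_nat_eq c (Nat.pos_of_ne_zero hn))]

/-! ### Euler operators `x_i ∂_i` -/

section Euler

variable {σ R : Type*} [CommRing R] [DecidableEq σ]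

/-- Euler operators act diagonally on monomials, which keeps the truncated exponent `n - 1` out of
all later formulas. -/
theorem X_mul_pderiv_X_pow (i j : σ) (n : ℕ) :
    MvPolynomial.X i * MvPolynomial.pderiv i (MvPolynomial.X j ^ n : MvPolynomial σ R) =
      if i = j then MvPolynomial.C (n : R) * MvPolynomial.X j ^ n else 0 := by
  split_ifs with h
  · subst h
    rcases n with _ | n
    · simp
    · rw [MvPolynomial.pderiv_pow, MvPolynomial.pderiv_X_self, Nat.add_sub_cancel, pow_succ,
        map_natCast]
      ring
  · simp [MvPolynomial.pderiv_X_of_ne (Ne.symm h)]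

theorem X_mul_pderiv_sum (s : Finset σ) (e : σ → ℕ) (i : σ) :
    MvPolynomial.X i * MvPolynomial.pderiv i
        (∑ l ∈ s, MvPolynomial.X l ^ e l : MvPolynomial σ R) =
      if i ∈ s then MvPolynomial.C (e i : R) * MvPolynomial.X i ^ e i else 0 := by
  rw [map_sum, Finset.mul_sum, Finset.sum_congr rfl fun j _ => X_mul_pderiv_X_pow i j (e j),
    Finset.sum_ite_eq]

theorem X_mul_pderiv_prod (s : Finset σ) (b : σ → ℕ) (i : σ) :
    MvPolynomial.X i * MvPolynomial.pderiv i
        (∏ l ∈ s, MvPolynomial.X l ^ b l : MvPolynomial σ R) =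
      if i ∈ s then MvPolynomial.C (b i : R) * ∏ l ∈ s, MvPolynomial.X l ^ b l else 0 := by
  induction s using Finset.induction with
  | empty => simp
  | insert j s hj ih =>
    rw [Finset.prod_insert hj, Derivation.leibniz, smul_eq_mul, smul_eq_mul, mul_add,
      mul_left_comm, ih, mul_left_comm, X_mul_pderiv_X_pow]
    by_cases hij : i = j
    · subst hij
      simp [hj]; ring
    · by_cases his : i ∈ s <;> simp [hij, his]
      ring

end Euler

theorem gcd_filter_eq_gcd_subtype {ι : Type*} [Fintype ι] (p : ι → Prop) [DecidablePred p]
    (f : ι → ℕ) :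
    (Finset.univ.filter p).gcd f = Finset.univ.gcd fun i : {i // p i} => f i := by
  refine Nat.dvd_antisymm ?_ ?_
  · exact Finset.dvd_gcd fun i _ => Finset.gcd_dvd (by simpa using i.2)
  · exact Finset.dvd_gcd fun i hi => Finset.gcd_dvd
      (f := fun i : {i // p i} => f i) (b := ⟨i, (Finset.mem_filter.1 hi).2⟩) (Finset.mem_univ _)

/-! ### The equations of singular vectors and their symmetries -/

section SingularVectors

variable {n : ℕ} {w β : Fin n → ℕ} {k d : ℕ} {a : ℂ}

/-- The monomial `∏_{i ≤ k} x_i ^ β_i`. -/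
def monomialValue (β : Fin n → ℕ) (k : ℕ) (v : Fin n → ℂ) : ℂ :=
  ∏ i with i.val < k, v i ^ β i

/-- The explicit form of the equations for singular points of the family. -/
def IsSingularVector (w β : Fin n → ℕ) (k d : ℕ) (a : ℂ) (v : Fin n → ℂ) : Prop :=
  (∀ i, k ≤ i.val → v i = 0) ∧ ∀ i, i.val < k → v i ≠ 0 ∧
    (d : ℂ) * v i ^ (d / w i) + a * (β i * w i) * monomialValue β k v = 0

theorem eval_familyPolynomial (v : Fin n → ℂ) :
    MvPolynomial.eval v (familyPolynomial w β k d a) =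
      ∑ i, v i ^ (d / w i) + a * monomialValue β k v := by
  simp [familyPolynomial, monomialValue]

/-- The extra factor `w i` turns the different exponents `d / w i` into the common coefficient `d`.
-/
theorem mul_eval_pderiv_familyPolynomial (hwd : ∀ i, w i ∣ d) (v : Fin n → ℂ) (i : Fin n) :
    (w i : ℂ) * (v i * MvPolynomial.eval v
        (MvPolynomial.pderiv i (familyPolynomial w β k d a))) =
      d * v i ^ (d / w i) +
        if i.val < k then a * (β i * w i) * monomialValue β k v else 0 := by
  have h : MvPolynomial.X i * MvPolynomial.pderiv i (familyPolynomial w β k d a) =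
      MvPolynomial.C ((d / w i : ℕ) : ℂ) * MvPolynomial.X i ^ (d / w i) +
        MvPolynomial.C a * if i ∈ Finset.univ.filter (fun i : Fin n => i.val < k) then
          MvPolynomial.C (β i : ℂ) * ∏ l with l.val < k, MvPolynomial.X l ^ β l else 0 := by
    rw [familyPolynomial, map_add, mul_add, X_mul_pderiv_sum, if_pos (Finset.mem_univ i),
      MvPolynomial.pderiv_C_mul, mul_left_comm, X_mul_pderiv_prod]
  have h' := congrArg (MvPolynomial.eval v) h
  rw [map_mul, MvPolynomial.eval_X] at h'
  have hdw : (w i : ℂ) * ((d / w i : ℕ) : ℂ) = d := by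
    rw [← Nat.cast_mul, Nat.mul_div_cancel' (hwd i)]
  rw [h']
  by_cases hi : i.val < k
  · simp [hi, monomialValue]
    linear_combination v i ^ (d / w i) * hdw
  · simp [hi]
    linear_combination v i ^ (d / w i) * hdw

theorem IsSingularVector.monomialValue_ne_zero {v : Fin n → ℂ}
    (h : IsSingularVector w β k d a v) : monomialValue β k v ≠ 0 :=
  Finset.prod_ne_zero_iff.2 fun i hi => pow_ne_zero _ (h.2 i (Finset.mem_filter.1 hi).2).1

theorem IsSingularVector.ne_zero {v : Fin n → ℂ} (hn : 0 < n) (hk : 1 ≤ k)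
    (h : IsSingularVector w β k d a v) : v ≠ 0 :=
  fun h0 => (h.2 ⟨0, hn⟩ hk).1 (congrFun h0 _)

theorem pos_of_sum_eq (hw : ∀ i, 0 < w i) (hd : d = ∑ i, w i) (i : Fin n) : 0 < d := by
  rw [hd]
  exact lt_of_lt_of_le (hw i) (Finset.single_le_sum (fun j _ => Nat.zero_le _) (Finset.mem_univ i))

theorem div_pos_of_dvd (hw : ∀ i, 0 < w i) (hwd : ∀ i, w i ∣ d) (hd : d = ∑ i, w i) (i : Fin n) :
    0 < d / w i :=
  Nat.div_pos (Nat.le_of_dvd (pos_of_sum_eq hw hd i) (hwd i)) (hw i)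

/-- As `k ≥ 1`, the coordinate `0` is not `i`, so `d ≥ w_0 + w_i > w_i`. This makes the derivative
of `x_i ^ (d / w_i)` vanish at `x_i = 0`. -/
theorem one_lt_div_of_le (hw : ∀ i, 0 < w i) (hwd : ∀ i, w i ∣ d) (hd : d = ∑ i, w i)
    (hk : 1 ≤ k) (i : Fin n) (hi : k ≤ i.val) : 1 < d / w i := by
  have h0 : (⟨0, i.pos⟩ : Fin n) ≠ i := fun h => by
    have := congrArg Fin.val h
    simp only at this
    omega
  have h1 : w ⟨0, i.pos⟩ + w i ≤ d := by
    rw [hd, ← Finset.sum_pair h0]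
    exact Finset.sum_le_sum_of_subset (Finset.subset_univ _)
  have h2 := hw ⟨0, i.pos⟩
  obtain ⟨c, hc⟩ := hwd i
  rw [hc, Nat.mul_div_cancel_left _ (hw i)]
  by_contra! h3
  have : w i * c ≤ w i := by nlinarith
  omega

theorem singular_iff_isSingularVector (hw : ∀ i, 0 < w i) (hwd : ∀ i, w i ∣ d)
    (hd : d = ∑ i, w i) (hk : 1 ≤ k) (hβ : ∀ i : Fin n, i.val < k → β i ≠ 0)
    (hβd : d = ∑ i : Fin n with i.val < k, β i * w i) {v : Fin n → ℂ} (hv : v ≠ 0) :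
    (MvPolynomial.eval v (familyPolynomial w β k d a) = 0 ∧
      ∀ i, MvPolynomial.eval v (MvPolynomial.pderiv i (familyPolynomial w β k d a)) = 0) ↔
      IsSingularVector w β k d a v := by
  obtain ⟨i₀, hi₀⟩ := Function.ne_iff.1 hv
  have hd0 : (d : ℂ) ≠ 0 := Nat.cast_ne_zero.2 (pos_of_sum_eq hw hd i₀).ne'
  have hE : ∀ i, (w i : ℂ) * (v i * MvPolynomial.eval v
        (MvPolynomial.pderiv i (familyPolynomial w β k d a))) =
      d * v i ^ (d / w i) +
        if i.val < k then a * (β i * w i) * monomialValue β k v else 0 :=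
    mul_eval_pderiv_familyPolynomial hwd v
  constructor
  · rintro ⟨-, h⟩
    simp only [h, mul_zero] at hE
    have h1 : ∀ i, k ≤ i.val → v i = 0 := fun i hi => by
      have := hE i
      rw [if_neg (by omega), add_zero, eq_comm, mul_eq_zero] at this
      exact pow_eq_zero_iff (div_pos_of_dvd hw hwd hd i).ne' |>.1 (this.resolve_left hd0)
    have h2 : ∀ i : Fin n, i.val < k →
        (d : ℂ) * v i ^ (d / w i) + a * (β i * w i) * monomialValue β k v = 0 := fun i hi => by
      have := hE i
      rw [if_pos hi] at this
      exact this.symm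
    refine ⟨h1, fun i hi => ⟨fun h0 => hi₀ ?_, h2 i hi⟩⟩
    -- One zero among the first `k` coordinates kills the monomial, and then the equations kill all
    -- coordinates.
    have hM : monomialValue β k v = 0 := Finset.prod_eq_zero (i := i) (by simpa using hi)
      (by rw [h0, zero_pow (hβ i hi)])
    rcases lt_or_ge i₀.val k with h | h
    · have := h2 i₀ h
      rw [hM, mul_zero, add_zero, mul_eq_zero] at this
      exact pow_eq_zero_iff (div_pos_of_dvd hw hwd hd i₀).ne' |>.1 (this.resolve_left hd0)
    · exact h1 i₀ h
  · intro h
    refine ⟨?_, fun i => ?_⟩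
    · rw [eval_familyPolynomial]
      refine (mul_eq_zero.1 (?_ : (d : ℂ) * _ = 0)).resolve_left hd0
      have h1 : ∀ i : Fin n, (d : ℂ) * v i ^ (d / w i) =
          if i.val < k then -(a * monomialValue β k v) * ((β i * w i : ℕ) : ℂ) else 0 :=
        fun i => by
          split_ifs with hi
          · push_cast
            linear_combination (h.2 i hi).2
          · rw [h.1 i (by omega), zero_pow (div_pos_of_dvd hw hwd hd i).ne', mul_zero]
      rw [mul_add, Finset.mul_sum, Finset.sum_congr rfl fun i _ => h1 i, ← Finset.sum_filter,
        ← Finset.mul_sum, ← Nat.cast_sum, ← hβd]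
      ring
    · rcases lt_or_ge i.val k with hi | hi
      · have h1 := hE i
        rw [if_pos hi, (h.2 i hi).2, mul_eq_zero, mul_eq_zero] at h1
        exact (h1.resolve_left (Nat.cast_ne_zero.2 (hw i).ne')).resolve_left (h.2 i hi).1
      -- Here `v i = 0`, so the Euler relation carries no information and the partial derivative is
      -- computed directly.
      · have hi' : i ∉ Finset.univ.filter (fun i : Fin n => i.val < k) := by
          simpa using hi
        have h1 := X_mul_pderiv_prod (R := ℂ)
          (Finset.univ.filter fun i : Fin n => i.val < k) β i
        rw [if_neg hi', mul_eq_zero] at h1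
        have h2 := h1.resolve_left (MvPolynomial.X_ne_zero i)
        have h3 := one_lt_div_of_le hw hwd hd hk i hi
        rw [familyPolynomial, map_add, MvPolynomial.pderiv_C_mul, h2, mul_zero, add_zero,
          map_sum, map_sum]
        refine Finset.sum_eq_zero fun j _ => ?_
        by_cases hj : j = i
        · subst hj
          simp [h.1 j hi, zero_pow (Nat.sub_ne_zero_of_lt h3)]
        · simp [MvPolynomial.pderiv_X_of_ne hj]

theorem monomialValue_scale (hβd : d = ∑ i : Fin n with i.val < k, β i * w i)
    (t : ℂ) (v : Fin n → ℂ) :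
    monomialValue β k (fun i => t ^ w i * v i) = t ^ d * monomialValue β k v := by
  simp only [monomialValue, mul_pow, Finset.prod_mul_distrib]
  congr 1
  rw [hβd, ← Finset.prod_pow_eq_pow_sum]
  exact Finset.prod_congr rfl fun i _ => by rw [← pow_mul, mul_comm]

theorem IsSingularVector.scale (hwd : ∀ i, w i ∣ d)
    (hβd : d = ∑ i : Fin n with i.val < k, β i * w i) {t : ℂ} (ht : t ≠ 0) {v : Fin n → ℂ}
    (h : IsSingularVector w β k d a v) :
    IsSingularVector w β k d a fun i => t ^ w i * v i := by
  refine ⟨fun i hi => by simp only [h.1 i hi, mul_zero],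
    fun i hi => ⟨mul_ne_zero (pow_ne_zero _ ht) (h.2 i hi).1, ?_⟩⟩
  rw [monomialValue_scale hβd, mul_pow, ← pow_mul, Nat.mul_div_cancel' (hwd i)]
  linear_combination t ^ d * (h.2 i hi).2

theorem mk_mem_singularPoints_iff (hw : ∀ i, 0 < w i) (hwd : ∀ i, w i ∣ d)
    (hd : d = ∑ i, w i) (hk : 1 ≤ k) (hβ : ∀ i : Fin n, i.val < k → β i ≠ 0)
    (hβd : d = ∑ i : Fin n with i.val < k, β i * w i) (v : {v : Fin n → ℂ // v ≠ 0}) :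
    WeightedProjectiveSpace.mk w v ∈ singularPoints w (familyPolynomial w β k d a) ↔
      IsSingularVector w β k d a v.1 := by
  constructor
  · rintro ⟨u, huv, hu⟩
    obtain ⟨t, ht⟩ := Quotient.exact huv
    have h1 := ((singular_iff_isSingularVector hw hwd hd hk hβ hβd u.2).1 hu).scale hwd hβd
      t.ne_zero
    rwa [show v.1 = fun i => (t : ℂ) ^ w i * u.1 i from funext ht]
  · intro h
    exact ⟨v, rfl, (singular_iff_isSingularVector hw hwd hd hk hβ hβd v.2).2 h⟩

/-- Multiplication of the first `k` coordinates by roots of unity. -/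
def twist (η : ∀ i : {i : Fin n // i.val < k}, rootsOfUnity (d / w i) ℂ) (v : Fin n → ℂ) :
    Fin n → ℂ :=
  fun i => if h : i.val < k then ((η ⟨i, h⟩ : ℂˣ) : ℂ) * v i else 0

theorem twist_pow (η : ∀ i : {i : Fin n // i.val < k}, rootsOfUnity (d / w i) ℂ)
    (v : Fin n → ℂ) (i : Fin n) (hi : i.val < k) :
    twist η v i ^ (d / w i) = v i ^ (d / w i) := by
  have h := (mem_rootsOfUnity _ _).1 (η ⟨i, hi⟩).2
  have h' := congrArg Units.val h
  simp only [Units.val_pow_eq_pow_val, Units.val_one] at h'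
  simp only [twist, hi, dif_pos, mul_pow, h', one_mul]

theorem monomialValue_twist (η : ∀ i : {i : Fin n // i.val < k}, rootsOfUnity (d / w i) ℂ)
    (v : Fin n → ℂ) :
    monomialValue β k (twist η v) =
      (monomialHom (fun i : {i : Fin n // i.val < k} => β i) _ η : ℂˣ) * monomialValue β k v := by
  have hs : ∀ x : Fin n, x ∈ Finset.univ.filter (fun i : Fin n => i.val < k) ↔ x.val < k := by
    simp
  simp only [monomialValue]
  rw [Finset.prod_subtype _ hs, Finset.prod_subtype _ hs]
  change _ = ((∏ i : {i : Fin n // i.val < k}, (η i : ℂˣ) ^ β i : ℂˣ) : ℂ) * _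
  rw [Units.coe_prod, ← Finset.prod_mul_distrib]
  refine Finset.prod_congr rfl fun i _ => ?_
  simp [twist, i.2, mul_pow]

/-- The equations involve only the powers `v_i ^ (d / w_i)`, which no twist changes, and the
monomial, which the kernel preserves. -/
theorem IsSingularVector.twist
    {η : ∀ i : {i : Fin n // i.val < k}, rootsOfUnity (d / w i) ℂ}
    (hη : η ∈ (monomialHom (fun i : {i : Fin n // i.val < k} => β i) _).ker)
    {v : Fin n → ℂ} (h : IsSingularVector w β k d a v) :
    IsSingularVector w β k d a (twist η v) := by
  refine ⟨fun i hi => by simp [FermatFamily.twist, not_lt.2 hi], fun i hi => ⟨?_, ?_⟩⟩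
  · simp [FermatFamily.twist, hi, (h.2 i hi).1]
  · rw [twist_pow η v i hi, monomialValue_twist, MonoidHom.mem_ker.1 hη, Units.val_one, one_mul]
    exact (h.2 i hi).2

end SingularVectors

/-! ### The discriminant -/

section Discriminant

variable {n : ℕ} {w β : Fin n → ℕ} {k d γ : ℕ} {a : ℂ}

theorem mem_discriminant_iff (hn : 0 < n) (hw : ∀ i, 0 < w i) (hwd : ∀ i, w i ∣ d)
    (hd : d = ∑ i, w i) (hk : 1 ≤ k) (hβ : ∀ i : Fin n, i.val < k → β i ≠ 0)
    (hβd : d = ∑ i : Fin n with i.val < k, β i * w i) :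
    a ∈ discriminant w β k d ↔ ∃ v, IsSingularVector w β k d a v := by
  constructor
  · rintro ⟨p, hp⟩
    obtain ⟨v, rfl⟩ := Quotient.exists_rep p
    exact ⟨v.1, (mk_mem_singularPoints_iff hw hwd hd hk hβ hβd v).1 hp⟩
  · rintro ⟨v, hv⟩
    exact ⟨WeightedProjectiveSpace.mk w ⟨v, hv.ne_zero hn hk⟩,
      (mk_mem_singularPoints_iff hw hwd hd hk hβ hβd _).2 hv⟩

theorem gcd_dvd_of_sum_eq (hβd : d = ∑ i : Fin n with i.val < k, β i * w i)
    (hγ : γ = (Finset.univ.filter fun i : Fin n => i.val < k).gcd fun i => β i * w i) :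
    γ ∣ d := by
  rw [hβd, hγ]
  exact Finset.dvd_sum fun i hi => Finset.gcd_dvd hi

theorem sum_div_gcd (hβd : d = ∑ i : Fin n with i.val < k, β i * w i)
    (hγ : γ = (Finset.univ.filter fun i : Fin n => i.val < k).gcd fun i => β i * w i) :
    ∑ i : Fin n with i.val < k, β i * w i / γ = d / γ := by
  rw [hβd, Nat.sum_div]
  intro i hi
  rw [hγ]
  exact Finset.gcd_dvd hi

/-- `(d / w_i) * (β_i w_i / γ) = β_i * (d / γ)`; this choice of exponents eliminates the
coordinates. -/
theorem prod_pow_eq_monomialValue_pow (hw : ∀ i, 0 < w i) (hwd : ∀ i, w i ∣ d) (hd : d ≠ 0)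
    (hβd : d = ∑ i : Fin n with i.val < k, β i * w i)
    (hγ : γ = (Finset.univ.filter fun i : Fin n => i.val < k).gcd fun i => β i * w i)
    (v : Fin n → ℂ) :
    ∏ i : Fin n with i.val < k, (v i ^ (d / w i)) ^ (β i * w i / γ) =
      monomialValue β k v ^ (d / γ) := by
  have hγd := gcd_dvd_of_sum_eq hβd hγ
  have hγ0 : 0 < γ := Nat.pos_of_dvd_of_pos hγd (Nat.pos_of_ne_zero hd)
  rw [monomialValue, ← Finset.prod_pow]
  refine Finset.prod_congr rfl fun i hi => ?_
  rw [← pow_mul, ← pow_mul]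
  congr 1
  have h1 : γ ∣ β i * w i := by
    rw [hγ]
    exact Finset.gcd_dvd hi
  obtain ⟨c, hc⟩ := h1
  obtain ⟨N, hN⟩ := hγd
  obtain ⟨e, he⟩ := hwd i
  rw [hc, Nat.mul_div_cancel_left _ hγ0]
  have h2 : d / w i = e := by rw [he, Nat.mul_div_cancel_left _ (hw i)]
  have h3 : d / γ = N := by rw [hN, Nat.mul_div_cancel_left _ hγ0]
  rw [h2, h3]
  refine Nat.eq_of_mul_eq_mul_right (Nat.mul_pos hγ0 (hw i)) ?_
  calc e * c * (γ * w i) = (w i * e) * (γ * c) := by ring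
    _ = (γ * N) * (β i * w i) := by rw [← he, ← hN, hc]
    _ = _ := by ring

/-- The ratio of the two values is a `d / γ`-th root of unity, hence a value of the monomial
character. -/
theorem exists_twist_monomialValue_eq (hwd : ∀ i, w i ∣ d) (hd : d ≠ 0)
    (hβd : d = ∑ i : Fin n with i.val < k, β i * w i)
    (hγ : γ = (Finset.univ.filter fun i : Fin n => i.val < k).gcd fun i => β i * w i)
    {v : Fin n → ℂ} {z : ℂ} (hv : monomialValue β k v ≠ 0)
    (hz : z ^ (d / γ) = monomialValue β k v ^ (d / γ)) :
    ∃ η : ∀ i : {i : Fin n // i.val < k}, rootsOfUnity (d / w i) ℂ,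
      monomialValue β k (twist η v) = z := by
  have hγd := gcd_dvd_of_sum_eq hβd hγ
  rw [gcd_filter_eq_gcd_subtype] at hγ
  have hN : d / γ ≠ 0 := (Nat.div_pos (Nat.le_of_dvd (Nat.pos_of_ne_zero hd) hγd)
      (Nat.pos_of_dvd_of_pos hγd (Nat.pos_of_ne_zero hd))).ne'
  have hz0 : z ≠ 0 := fun h => by
    rw [h, zero_pow hN] at hz
    exact pow_ne_zero _ hv hz.symm
  have hr := range_monomialHom (fun i : {i : Fin n // i.val < k} => w i)
    (fun i => β i) (fun i => d / w i) d hd (fun i => Nat.div_mul_cancel (hwd i)) (hγ ▸ hγd)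
  rw [← hγ] at hr
  have hω : Units.mk0 (z / monomialValue β k v) (div_ne_zero hz0 hv) ∈ rootsOfUnity (d / γ) ℂ := by
    rw [mem_rootsOfUnity, Units.ext_iff]
    simp [div_pow, hz, hv]
  rw [← hr] at hω
  obtain ⟨η, hη⟩ := hω
  refine ⟨η, ?_⟩
  rw [monomialValue_twist, hη, Units.val_mk0, div_mul_cancel₀ _ hv]

theorem exists_isSingularVector_iff (hn : 0 < n) (hw : ∀ i, 0 < w i) (hwd : ∀ i, w i ∣ d)
    (hd : d = ∑ i, w i) (hβ : ∀ i : Fin n, i.val < k → β i ≠ 0)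
    (hβd : d = ∑ i : Fin n with i.val < k, β i * w i)
    (hγ : γ = (Finset.univ.filter fun i : Fin n => i.val < k).gcd fun i => β i * w i) :
    (∃ v, IsSingularVector w β k d a v) ↔
      (-a) ^ (d / γ) * ∏ i : Fin n with i.val < k,
        ((β i : ℂ) * (w i : ℂ)) ^ (β i * w i / γ) = (d : ℂ) ^ (d / γ) := by
  have hd0 : d ≠ 0 := (pos_of_sum_eq hw hd ⟨0, hn⟩).ne'
  have hdc : (d : ℂ) ≠ 0 := Nat.cast_ne_zero.2 hd0
  have hγd := gcd_dvd_of_sum_eq hβd hγ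
  have hN : d / γ ≠ 0 := (Nat.div_pos (Nat.le_of_dvd (Nat.pos_of_ne_zero hd0) hγd)
      (Nat.pos_of_dvd_of_pos hγd (Nat.pos_of_ne_zero hd0))).ne'
  have hprod := prod_pow_eq_monomialValue_pow hw hwd hd0 hβd hγ
  have hsum : ∀ x : ℂ, ∏ i : Fin n with i.val < k, x ^ (β i * w i / γ) = x ^ (d / γ) := fun x => by
    rw [Finset.prod_pow_eq_pow_sum, sum_div_gcd hβd hγ]
  constructor
  · rintro ⟨v, hv⟩
    have h1 : ∏ i : Fin n with i.val < k, ((d : ℂ) * v i ^ (d / w i)) ^ (β i * w i / γ) =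
        ∏ i : Fin n with i.val < k,
          ((-a) * monomialValue β k v * ((β i : ℂ) * (w i : ℂ))) ^ (β i * w i / γ) := by
      refine Finset.prod_congr rfl fun i hi => ?_
      congr 1
      linear_combination (hv.2 i (Finset.mem_filter.1 hi).2).2
    simp only [mul_pow _ _ (_ / _), Finset.prod_mul_distrib, hsum] at h1
    rw [hprod] at h1
    refine mul_right_cancel₀ (pow_ne_zero (d / γ) hv.monomialValue_ne_zero) ?_
    rw [h1]
    simp only [mul_pow _ _ (_ / _), Finset.prod_mul_distrib]
    ring
  · intro h
    have ha : a ≠ 0 := by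
      rintro rfl
      rw [neg_zero, zero_pow hN, zero_mul] at h
      exact pow_ne_zero _ hdc h.symm
    have he : ∀ i, 0 < d / w i := div_pos_of_dvd hw hwd hd
    choose y hy using fun i => IsAlgClosed.exists_pow_nat_eq ((β i : ℂ) * (w i : ℂ)) (he i)
    have hMy : monomialValue β k y ≠ 0 := Finset.prod_ne_zero_iff.2 fun i hi => by
      have hi := (Finset.mem_filter.1 hi).2
      refine pow_ne_zero _ fun h0 => ?_
      have h1 := hy i
      rw [h0, zero_pow (he i).ne'] at h1
      exact mul_ne_zero (Nat.cast_ne_zero.2 (hβ i hi)) (Nat.cast_ne_zero.2 (hw i).ne') h1.symm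
    have hP := hprod y
    simp only [hy] at hP
    rw [hP] at h
    -- Once `y_i ^ (d / w_i) = β_i w_i`, all equations reduce to `d + a M = 0`, which prescribes the
    -- value of the monomial.
    obtain ⟨η, hη⟩ := exists_twist_monomialValue_eq (z := d / (-a)) hwd hd0 hβd hγ hMy (by
      rw [div_pow, div_eq_iff (pow_ne_zero _ (neg_ne_zero.2 ha)), ← h, mul_comm])
    refine ⟨twist η y, fun i hi => by simp [twist, not_lt.2 hi], fun i hi => ⟨?_, ?_⟩⟩
    · have hyi : y i ≠ 0 := fun h0 => hMy (Finset.prod_eq_zero (i := i) (by simpa using hi)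
        (by rw [h0, zero_pow (hβ i hi)]))
      simp [twist, hi, hyi]
    · rw [twist_pow η y i hi, hη, hy]
      field_simp
      ring

theorem discriminant_eq (hn : 0 < n) (hw : ∀ i, 0 < w i) (hwd : ∀ i, w i ∣ d)
    (hd : d = ∑ i, w i) (hk : 1 ≤ k) (hβ : ∀ i : Fin n, i.val < k → β i ≠ 0)
    (hβd : d = ∑ i : Fin n with i.val < k, β i * w i)
    (hγ : γ = (Finset.univ.filter fun i : Fin n => i.val < k).gcd fun i => β i * w i) :
    discriminant w β k d =
        {a : ℂ | a ^ (d / γ) + (-1) ^ (d / γ - 1) *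
          ((d : ℂ) ^ (d / γ) /
            ∏ i : Fin n with i.val < k,
              ((β i : ℂ) * (w i : ℂ)) ^ (β i * w i / γ)) = 0} ∧
      (discriminant w β k d).ncard = d / γ := by
  have hd0 : d ≠ 0 := (pos_of_sum_eq hw hd ⟨0, hn⟩).ne'
  have hdc : (d : ℂ) ≠ 0 := Nat.cast_ne_zero.2 hd0
  have hγd := gcd_dvd_of_sum_eq hβd hγ
  have hN : d / γ ≠ 0 := (Nat.div_pos (Nat.le_of_dvd (Nat.pos_of_ne_zero hd0) hγd)
      (Nat.pos_of_dvd_of_pos hγd (Nat.pos_of_ne_zero hd0))).ne'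
  have hP : ∏ i : Fin n with i.val < k,
      ((β i : ℂ) * (w i : ℂ)) ^ (β i * w i / γ) ≠ 0 := Finset.prod_ne_zero_iff.2 fun i hi =>
    pow_ne_zero _ (mul_ne_zero (Nat.cast_ne_zero.2 (hβ i (Finset.mem_filter.1 hi).2))
      (Nat.cast_ne_zero.2 (hw i).ne'))
  have hmem : ∀ a, a ∈ discriminant w β k d ↔ _ := fun a =>
    (mem_discriminant_iff hn hw hwd hd hk hβ hβd).trans
      (exists_isSingularVector_iff (a := a) hn hw hwd hd hβ hβd hγ)
  set P := ∏ i : Fin n with i.val < k, ((β i : ℂ) * (w i : ℂ)) ^ (β i * w i / γ)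
  -- Writing `d / γ = N + 1` makes the subtraction in `d / γ - 1` exact.
  obtain ⟨N, hNN⟩ := Nat.exists_eq_succ_of_ne_zero hN
  rw [Nat.succ_eq_add_one] at hNN
  have hsign : ((-1 : ℂ) ^ N) * (-1) ^ N = 1 := by rw [← mul_pow]; simp
  constructor
  · ext a
    rw [hmem, Set.mem_ofPred_eq, hNN, Nat.add_sub_cancel, neg_pow, pow_succ (-1 : ℂ)]
    constructor
    · intro h
      rw [← h]
      field_simp
      linear_combination (-a ^ (N + 1)) * hsign
    · intro h
      have h' : a ^ (N + 1) * P + (-1) ^ N * (d : ℂ) ^ (N + 1) = 0 := by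
        have := congrArg (· * P) h
        simp only [zero_mul] at this
        rw [← this]
        field_simp
      linear_combination (-(-1) ^ N) * h' + (d : ℂ) ^ (N + 1) * hsign
  · have hset : discriminant w β k d =
        {a : ℂ | a ^ (d / γ) = (-1) ^ (d / γ) * (d : ℂ) ^ (d / γ) / P} := by
      ext a
      rw [hmem, Set.mem_ofPred_eq, hNN, eq_div_iff hP, neg_pow, pow_succ (-1 : ℂ)]
      constructor
      · intro h
        rw [← h]
        linear_combination (-a ^ (N + 1) * P) * hsign
      · intro h
        linear_combination (-(-1) ^ N) * h + (d : ℂ) ^ (N + 1) * hsign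
    rw [hset]
    exact ncard_setOf_pow_eq hN (div_ne_zero (mul_ne_zero (pow_ne_zero _ (by simp))
      (pow_ne_zero _ hdc)) hP)

end Discriminant

/-! ### Counting singular points as cosets -/

section Counting

variable {n : ℕ} {w β : Fin n → ℕ} {k d : ℕ} {a : ℂ}

theorem finite_singularPoints_and_ncard (hn : 0 < n) (hw : ∀ i, 0 < w i) (hwd : ∀ i, w i ∣ d)
    (hd : d = ∑ i, w i) (hk : 1 ≤ k) (hβ : ∀ i : Fin n, i.val < k → β i ≠ 0)
    (hβd : d = ∑ i : Fin n with i.val < k, β i * w i)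
    {v₀ : Fin n → ℂ} (hv₀ : IsSingularVector w β k d a v₀) :
    (singularPoints w (familyPolynomial w β k d a)).Finite ∧
      (singularPoints w (familyPolynomial w β k d a)).ncard =
        (scalingHom (fun i : {i : Fin n // i.val < k} => w i) (fun i => d / w i) d
          fun i => Nat.div_mul_cancel (hwd i)).range.relIndex
          (monomialHom (fun i : {i : Fin n // i.val < k} => β i) fun i => d / w i).ker := by
  have hd0 : d ≠ 0 := (pos_of_sum_eq hw hd ⟨0, hn⟩).ne'
  have hdc : (d : ℂ) ≠ 0 := Nat.cast_ne_zero.2 hd0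
  set K := (monomialHom (fun i : {i : Fin n // i.val < k} => β i) fun i => d / w i).ker with hK
  set ψ := scalingHom (fun i : {i : Fin n // i.val < k} => w i) (fun i => d / w i) d
          fun i => Nat.div_mul_cancel (hwd i) with hψ
  have hmem := mk_mem_singularPoints_iff (a := a) hw hwd hd hk hβ hβd
  let F : K → singularPoints w (familyPolynomial w β k d a) := fun η =>
    ⟨WeightedProjectiveSpace.mk w ⟨twist η.1 v₀, (hv₀.twist η.2).ne_zero hn hk⟩,
      (hmem _).2 (hv₀.twist η.2)⟩
  have hsurj : Function.Surjective F := by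
    rintro ⟨p, hp⟩
    obtain ⟨v, rfl⟩ := Quotient.exists_rep p
    have hv := (hmem v).1 hp
    -- Scaling by `t` multiplies the monomial by `t ^ d`, so its value can be matched with that at
    -- `v₀`; the equations then fix every `u_i ^ (d / w_i)`, and `u` is a twist of `v₀`.
    obtain ⟨t, ht⟩ := IsAlgClosed.exists_pow_nat_eq
      (monomialValue β k v₀ / monomialValue β k v.1) (Nat.pos_of_ne_zero hd0)
    have ht0 : t ≠ 0 := by
      rintro rfl
      rw [zero_pow hd0] at ht
      exact div_ne_zero hv₀.monomialValue_ne_zero hv.monomialValue_ne_zero ht.symm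
    have hu := hv.scale hwd hβd ht0
    have hM := monomialValue_scale hβd t v.1
    rw [ht, div_mul_cancel₀ _ hv.monomialValue_ne_zero] at hM
    set u : Fin n → ℂ := fun i => t ^ w i * v.1 i with hudef
    have hpow : ∀ i : Fin n, i.val < k → u i ^ (d / w i) = v₀ i ^ (d / w i) := fun i hi => by
      refine mul_left_cancel₀ hdc ?_
      have h1 := (hu.2 i hi).2
      have h2 := (hv₀.2 i hi).2
      rw [hM] at h1
      linear_combination h1 - h2
    let η : ∀ i : {i : Fin n // i.val < k}, rootsOfUnity (d / w i) ℂ := fun i =>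
      ⟨Units.mk0 (u i / v₀ i) (div_ne_zero (hu.2 i i.2).1 (hv₀.2 i i.2).1), by
        rw [mem_rootsOfUnity, Units.ext_iff]
        simp [div_pow, hpow i i.2, (hv₀.2 i i.2).1]⟩
    have hηu : twist η v₀ = u := by
      funext i
      by_cases hi : i.val < k
      · simp [twist, hi, η, (hv₀.2 i hi).1]
      · simp [twist, hi, hu.1 i (not_lt.1 hi)]
    have hηK : η ∈ K := by
      rw [hK, MonoidHom.mem_ker, Units.ext_iff]
      have := monomialValue_twist (β := β) η v₀
      rw [hηu, hM] at this
      exact (mul_right_cancel₀ hv₀.monomialValue_ne_zero (by rw [Units.val_one, one_mul, ← this]))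
    refine ⟨⟨η, hηK⟩, Subtype.ext ?_⟩
    refine Quotient.sound ⟨(Units.mk0 t ht0)⁻¹, fun i => ?_⟩
    simp only [hηu, hudef, Units.val_inv_eq_inv_val, Units.val_mk0, inv_pow]
    rw [inv_mul_cancel_left₀ (pow_ne_zero _ ht0)]
  -- Both twists have the same monomial value, so a scaling between them satisfies `t ^ d = 1`.
  have hfib : ∀ η θ : K, F η = F θ ↔ η.1⁻¹ * θ.1 ∈ ψ.range := by
    intro η θ
    rw [Subtype.ext_iff]
    constructor
    · intro h
      obtain ⟨t, ht⟩ := Quotient.exact h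
      have ht' : FermatFamily.twist θ.1 v₀ =
        fun i => (t : ℂ) ^ w i * FermatFamily.twist η.1 v₀ i := funext ht
      have hM := congrArg (monomialValue β k) ht'
      rw [monomialValue_scale hβd, monomialValue_twist, monomialValue_twist,
        MonoidHom.mem_ker.1 η.2, MonoidHom.mem_ker.1 θ.2, Units.val_one, one_mul] at hM
      have htd : (t : ℂ) ^ d = 1 := by
        refine mul_right_cancel₀ hv₀.monomialValue_ne_zero ?_
        rw [← hM, one_mul]
      refine ⟨⟨t, by rw [mem_rootsOfUnity, Units.ext_iff]; simpa using htd⟩, ?_⟩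
      funext i
      refine Subtype.ext ?_
      change t ^ w i = (η.1 i : ℂˣ)⁻¹ * (θ.1 i : ℂˣ)
      rw [eq_inv_mul_iff_mul_eq, Units.ext_iff]
      have h1 := ht i.1
      simp only [FermatFamily.twist, i.2, dif_pos] at h1
      refine mul_right_cancel₀ (hv₀.2 i i.2).1 ?_
      push_cast
      linear_combination -h1
    · rintro ⟨t, ht⟩
      refine Quotient.sound ⟨t.1, fun i => ?_⟩
      by_cases hi : i.val < k
      · have h1 : (t : ℂˣ) ^ w i = (η.1 ⟨i, hi⟩ : ℂˣ)⁻¹ * (θ.1 ⟨i, hi⟩ : ℂˣ) :=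
          congrArg Subtype.val (congrFun ht ⟨i, hi⟩)
        rw [eq_inv_mul_iff_mul_eq, Units.ext_iff] at h1
        push_cast at h1
        simp only [FermatFamily.twist, hi, dif_pos]
        linear_combination (-v₀ i) * h1
      · simp [FermatFamily.twist, hi]
  have hfin : Finite K := by
    refine Nat.finite_of_card_ne_zero fun h0 => ?_
    have h1 := card_ker_monomialHom_mul (fun i : {i : Fin n // i.val < k} => w i)
      (fun i => β i) (fun i => d / w i) d hd0 (fun i => Nat.div_mul_cancel (hwd i)) (by
        rw [← gcd_filter_eq_gcd_subtype (fun i : Fin n => i.val < k) fun i => β i * w i]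
        exact gcd_dvd_of_sum_eq hβd rfl)
    rw [← hK, h0, zero_mul] at h1
    exact Finset.prod_ne_zero_iff.2 (fun i _ => (div_pos_of_dvd hw hwd hd i.1).ne') h1.symm
  refine ⟨?_, ?_⟩
  · have := Finite.of_surjective F hsurj
    exact Set.toFinite _
  · rw [← Nat.card_coe_set_eq, Subgroup.relIndex, Subgroup.index]
    refine Nat.card_congr ((Setoid.quotientKerEquivOfSurjective F hsurj).symm.trans
      (Quotient.congrRight fun η θ => ?_))
    rw [QuotientGroup.leftRel_apply, Subgroup.mem_subgroupOf]
    exact hfib η θ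

end Counting

/-! ### Nondegeneracy of the chart equation in the monomial's variables -/

section ChartPolynomial

variable {σ : Type*} [Fintype σ]

/-- The polynomial `1 + ∑ x_i ^ e_i + a * ∏ x_i ^ b_i`. -/
def chartPolynomial (b e : σ → ℕ) (a : ℂ) : MvPolynomial σ ℂ :=
  1 + ∑ i, MvPolynomial.X i ^ e i + MvPolynomial.C a * ∏ i, MvPolynomial.X i ^ b i

theorem X_mul_pderiv_chartPolynomial [DecidableEq σ] (b e : σ → ℕ) (a : ℂ) (i : σ) :
    MvPolynomial.X i * MvPolynomial.pderiv i (chartPolynomial b e a) =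
      MvPolynomial.C (e i : ℂ) * MvPolynomial.X i ^ e i +
        MvPolynomial.C (a * b i) * ∏ l, MvPolynomial.X l ^ b l := by
  rw [chartPolynomial, map_add, map_add, MvPolynomial.pderiv_one, zero_add,
    MvPolynomial.pderiv_C_mul, mul_add, mul_left_comm, X_mul_pderiv_sum, X_mul_pderiv_prod,
    if_pos (Finset.mem_univ i), if_pos (Finset.mem_univ i), map_mul, mul_assoc]

variable {b e ω : σ → ℕ} {d B : ℕ} {a : ℂ} {p : σ → ℂ}

/-- `B` is the product `β_j w_j` of the coordinate set to `1`, and `h₀` is its equation; adding up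
all equations gives the claim, by `hsum`. -/
theorem eval_chartPolynomial_eq_zero (hsum : ∑ i, b i * ω i + B = d) (hB : B ≠ 0)
    (h₀ : (d : ℂ) + a * B * ∏ l, p l ^ b l = 0)
    (h : ∀ i, (d : ℂ) * p i ^ e i + a * (b i * ω i) * ∏ l, p l ^ b l = 0) :
    MvPolynomial.eval p (chartPolynomial b e a) = 0 := by
  have hd : (d : ℂ) ≠ 0 := Nat.cast_ne_zero.2 (by omega)
  have hs : (∑ i, (b i : ℂ) * ω i) + B = d := by exact_mod_cast congrArg (Nat.cast (R := ℂ)) hsum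
  refine (mul_eq_zero.1 (?_ : (d : ℂ) * _ = 0)).resolve_left hd
  simp only [chartPolynomial, map_add, map_mul, map_one, map_sum, map_pow, map_prod,
    MvPolynomial.eval_X, MvPolynomial.eval_C]
  have h1 : (d : ℂ) * ∑ i, p i ^ e i = -(a * ∏ l, p l ^ b l) * ∑ i, (b i : ℂ) * ω i := by
    rw [Finset.mul_sum, Finset.mul_sum]
    exact Finset.sum_congr rfl fun i _ => by linear_combination h i
  rw [mul_add, mul_add, h1]
  linear_combination h₀ - (a * ∏ l, p l ^ b l) * hs

theorem eval_pderiv_chartPolynomial_eq_zero [DecidableEq σ] (hp : ∀ i, p i ≠ 0) (hω : ∀ i, e i * ω i = d)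
    (hd : d ≠ 0)
    (h : ∀ i, (d : ℂ) * p i ^ e i + a * (b i * ω i) * ∏ l, p l ^ b l = 0) (i : σ) :
    MvPolynomial.eval p (MvPolynomial.pderiv i (chartPolynomial b e a)) = 0 := by
  have hω0 : (ω i : ℂ) ≠ 0 := Nat.cast_ne_zero.2 fun h0 => hd (by rw [← hω i, h0, mul_zero])
  have h1 := congrArg (MvPolynomial.eval p) (X_mul_pderiv_chartPolynomial b e a i)
  simp only [map_add, map_mul, map_pow, map_prod, MvPolynomial.eval_X, MvPolynomial.eval_C] at h1
  have h2 : (e i : ℂ) * ω i = d := by exact_mod_cast congrArg (Nat.cast (R := ℂ)) (hω i)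
  refine (mul_eq_zero.1 (?_ : (ω i * p i : ℂ) * _ = 0)).resolve_left (mul_ne_zero hω0 (hp i))
  linear_combination (ω i : ℂ) * h1 + h i + p i ^ e i * h2

/-- At a critical point `x_i x_j ∂_i ∂_j` has the same value as `(x_i ∂_i)(x_j ∂_j)`, since they
differ by a multiple of a first derivative. -/
theorem mul_hessian_chartPolynomial [DecidableEq σ]
    (hcrit : ∀ i, MvPolynomial.eval p (MvPolynomial.pderiv i (chartPolynomial b e a)) = 0)
    (i j : σ) :
    p i * p j * hessian (chartPolynomial b e a) p i j =
      (if i = j then (e j : ℂ) ^ 2 * p j ^ e j else 0) +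
        a * b i * b j * ∏ l, p l ^ b l := by
  have h1 : MvPolynomial.X i * MvPolynomial.pderiv i
      (MvPolynomial.X j * MvPolynomial.pderiv j (chartPolynomial b e a)) =
      MvPolynomial.C (e j : ℂ) *
        (if i = j then MvPolynomial.C (e j : ℂ) * MvPolynomial.X j ^ e j else 0) +
      MvPolynomial.C (a * b j) * (MvPolynomial.C (b i : ℂ) * ∏ l, MvPolynomial.X l ^ b l) := by
    rw [X_mul_pderiv_chartPolynomial, map_add, mul_add, MvPolynomial.pderiv_C_mul,
      MvPolynomial.pderiv_C_mul, mul_left_comm, X_mul_pderiv_X_pow,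
      mul_left_comm (MvPolynomial.X i), X_mul_pderiv_prod, if_pos (Finset.mem_univ i)]
  have h2 := congrArg (MvPolynomial.eval p) h1
  simp only [Derivation.leibniz, map_add, smul_eq_mul, map_mul, map_pow, map_prod,
    MvPolynomial.eval_X, MvPolynomial.eval_C, hcrit, zero_mul, add_zero,
    apply_ite (MvPolynomial.eval p), map_zero] at h2
  simp only [hessian, Matrix.of_apply]
  rw [mul_assoc, h2]
  split_ifs <;> ring

/-- For `v` in the kernel, put `u_i = v_i / p_i` and `c = ∑ b_j u_j`. The rows and the equations at
`p` give `e_i u_i = c`, that is `d u_i = ω_i c`. Weighting by `b_i` and summing gives `d c = (d - B)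
c`, so `c = 0` because `B ≠ 0`, and `v = 0`. -/
theorem isUnit_det_hessian_chartPolynomial [DecidableEq σ] (hp : ∀ i, p i ≠ 0) (hω : ∀ i, e i * ω i = d)
    (hb : ∀ i, b i ≠ 0) (hsum : ∑ i, b i * ω i + B = d) (hB : B ≠ 0)
    (h₀ : (d : ℂ) + a * B * ∏ l, p l ^ b l = 0)
    (h : ∀ i, (d : ℂ) * p i ^ e i + a * (b i * ω i) * ∏ l, p l ^ b l = 0) :
    IsUnit (hessian (chartPolynomial b e a) p).det := by
  have hdn : d ≠ 0 := by omega
  have hd : (d : ℂ) ≠ 0 := Nat.cast_ne_zero.2 hdn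
  have hcrit := eval_pderiv_chartPolynomial_eq_zero hp hω hdn h
  have hs : (∑ i, (b i : ℂ) * ω i) + B = d := by exact_mod_cast congrArg (Nat.cast (R := ℂ)) hsum
  have hω0 : ∀ i, (ω i : ℂ) ≠ 0 := fun i =>
    Nat.cast_ne_zero.2 fun h0 => hdn (by rw [← hω i, h0, mul_zero])
  have haM : a * ∏ l, p l ^ b l ≠ 0 := fun h0 => hd (by linear_combination h₀ - (B : ℂ) * h0)
  have hHess := mul_hessian_chartPolynomial hcrit
  set M := ∏ l, p l ^ b l
  rw [isUnit_iff_ne_zero]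
  intro hdet
  obtain ⟨v, hv, hv0⟩ := Matrix.exists_mulVec_eq_zero_iff.2 hdet
  set c := ∑ j, (b j : ℂ) * (v j / p j) with hc
  have h1 : ∀ i, (e i : ℂ) * (v i / p i) = c := by
    intro i
    have hi : ∑ j, hessian (chartPolynomial b e a) p i j * v j = 0 := congrFun hv0 i
    have hi' : (e i : ℂ) ^ 2 * p i ^ e i * (v i / p i) + a * b i * M * c = 0 := by
      have : ∑ j, (p i * p j * hessian (chartPolynomial b e a) p i j) * (v j / p j) = 0 := by
        calc _ = p i * ∑ j, hessian (chartPolynomial b e a) p i j * v j := by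
              rw [Finset.mul_sum]
              refine Finset.sum_congr rfl fun j _ => ?_
              have := hp j
              field_simp
          _ = 0 := by rw [hi, mul_zero]
      simp only [hHess, add_mul, Finset.sum_add_distrib, ite_mul, zero_mul, Finset.sum_ite_eq,
        Finset.mem_univ, if_true] at this
      rw [← this, hc, Finset.mul_sum]
      congr 1
      exact Finset.sum_congr rfl fun j _ => by ring
    have h2 : (e i : ℂ) * ω i = d := by exact_mod_cast congrArg (Nat.cast (R := ℂ)) (hω i)
    have hne : a * M * b i * ω i ≠ 0 :=
      mul_ne_zero (mul_ne_zero haM (Nat.cast_ne_zero.2 (hb i))) (hω0 i)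
    refine sub_eq_zero.1 ((mul_eq_zero.1 (?_ : a * M * b i * ω i * _ = 0)).resolve_left hne)
    linear_combination (e i : ℂ) * (v i / p i) * h i - (ω i : ℂ) * hi' +
      (e i : ℂ) * p i ^ e i * (v i / p i) * h2
  have h2 : ∀ i, (d : ℂ) * (v i / p i) = ω i * c := fun i => by
    rw [← h1 i, ← mul_assoc, ← show (e i : ℂ) * ω i = d by
      exact_mod_cast congrArg (Nat.cast (R := ℂ)) (hω i)]
    ring
  have h3 : (d : ℂ) * c = (∑ i, (b i : ℂ) * ω i) * c := by
    rw [hc, Finset.mul_sum, Finset.sum_mul]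
    refine Finset.sum_congr rfl fun i _ => ?_
    linear_combination (b i : ℂ) * h2 i
  have h4 : c = 0 := by
    refine (mul_eq_zero.1 (?_ : (B : ℂ) * c = 0)).resolve_left (Nat.cast_ne_zero.2 hB)
    linear_combination h3 + c * hs
  refine hv (funext fun i => ?_)
  have h5 := h2 i
  rw [h4, mul_zero, mul_eq_zero, div_eq_zero_iff] at h5
  exact (h5.resolve_left hd).resolve_right (hp i)

end ChartPolynomial

/-! ### Orbifold charts -/

section Charts

variable {m : ℕ} {w β : Fin (m + 1) → ℕ} {k d : ℕ} {a : ℂ} {j : Fin (m + 1)}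

/-- Omitting any one of the first `k` coordinates leaves the same range of chart indices, so one
normal form serves every such chart. -/
theorem succAbove_val_lt_iff (hj : j.val < k) (i : Fin m) :
    (j.succAbove i).val < k ↔ i.succ.val < k := by
  rcases lt_or_ge i.castSucc j with h | h
  · rw [Fin.succAbove_of_castSucc_lt _ _ h]
    have : i.val < j.val := h
    simp only [Fin.val_castSucc, Fin.val_succ]
    omega
  · rw [Fin.succAbove_of_le_castSucc _ _ h]

theorem succAbove_eq_succ (hj : j.val < k) (i : Fin m) (hi : ¬ i.succ.val < k) :
    j.succAbove i = i.succ := by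
  refine Fin.succAbove_of_le_castSucc _ _ ?_
  rw [Fin.le_def]
  simp only [Fin.val_castSucc, Fin.val_succ] at hi ⊢
  omega

/-- Separation of the coordinate `j` in a product over the first `k` coordinates. -/
theorem prod_lt_eq_mul_prod_succAbove {M : Type*} [CommMonoid M] (hj : j.val < k)
    (f : Fin (m + 1) → M) :
    ∏ i : Fin (m + 1) with i.val < k, f i =
      f j * ∏ i : {i : Fin m // i.succ.val < k}, f (j.succAbove i) := by
  rw [Finset.prod_filter, Fin.prod_univ_succAbove _ j, if_pos hj]
  simp only [succAbove_val_lt_iff hj]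
  rw [← Finset.prod_filter, Finset.prod_subtype (p := fun i : Fin m => i.succ.val < k) _ (by simp)]

/-- The monomial does not involve the last variables, so the equation separates. -/
theorem chartEquation_familyPolynomial (hj : j.val < k) :
    chartEquation (familyPolynomial w β k d a) j =
      MvPolynomial.rename Subtype.val
        (chartPolynomial (fun i : {i : Fin m // i.succ.val < k} => β (j.succAbove i))
          (fun i => d / w (j.succAbove i)) a) +
      ∑ i : Fin m with ¬ i.succ.val < k, MvPolynomial.X i ^ (d / w i.succ) := by
  have h1 : ∑ i : Fin m, (MvPolynomial.X i : MvPolynomial (Fin m) ℂ) ^ (d / w (j.succAbove i)) =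
      ∑ i : {i : Fin m // i.succ.val < k}, MvPolynomial.X i.1 ^ (d / w (j.succAbove i)) +
      ∑ i : Fin m with ¬ i.succ.val < k, MvPolynomial.X i ^ (d / w i.succ) := by
    rw [← Finset.sum_filter_add_sum_filter_not _ (fun i : Fin m => i.succ.val < k),
      Finset.sum_subtype (p := fun i : Fin m => i.succ.val < k) _ (by simp)]
    congr 1
    exact Finset.sum_congr rfl fun i hi => by
      rw [succAbove_eq_succ hj i (Finset.mem_filter.1 hi).2]
  simp only [chartEquation, familyPolynomial, chartPolynomial, map_add, map_sum, map_mul, map_prod,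
    map_pow, map_one, MvPolynomial.aeval_X, MvPolynomial.rename_X,
    MvPolynomial.algHom_C]
  rw [prod_lt_eq_mul_prod_succAbove hj, Fin.sum_univ_succAbove _ j]
  simp only [Fin.insertNth_apply_same, Fin.insertNth_apply_succAbove, one_pow, one_mul]
  rw [h1, MvPolynomial.algebraMap_eq]
  ring

theorem normalForm_eq :
    normalForm w k d = (∑ i : Fin m with i.succ.val < k, MvPolynomial.X i ^ 2) +
      ∑ i : Fin m with ¬ i.succ.val < k, MvPolynomial.X i ^ (d / w i.succ) := by
  simp only [normalForm, not_lt]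

theorem prod_le_eq_prod_ite (hk : 1 ≤ k) (f : Fin (m + 1) → ℕ) :
    ∏ i : Fin (m + 1) with k ≤ i.val, f i =
      ∏ i : Fin m, if i.succ.val < k then 1 else f i.succ := by
  rw [Finset.prod_filter, Fin.prod_univ_succ, if_neg (by rw [Fin.val_zero]; omega), one_mul]
  refine Finset.prod_congr rfl fun i _ => ?_
  by_cases h : i.succ.val < k
  · rw [if_neg (not_le.2 h), if_pos h]
  · rw [if_pos (not_lt.1 h), if_neg h]

theorem IsSingularVector.hasLocalEquation_and_milnorNumber (hw : ∀ i, 0 < w i)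
    (hwd : ∀ i, w i ∣ d) (hd : d = ∑ i, w i) (hk : 1 ≤ k)
    (hβ : ∀ i : Fin (m + 1), i.val < k → β i ≠ 0)
    (hβd : d = ∑ i : Fin (m + 1) with i.val < k, β i * w i) {y : Fin m → ℂ}
    (hy : IsSingularVector w β k d a (j.insertNth (α := fun _ => ℂ) 1 y)) :
    HasLocalEquation (chartEquation (familyPolynomial w β k d a) j) y (normalForm w k d) ∧
      milnorNumber (chartEquation (familyPolynomial w β k d a) j) y =
        ((∏ i : Fin (m + 1) with k ≤ i.val, (d / w i - 1) : ℕ) : ℕ∞) := by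
  -- The coordinate `j` equals `1`, while the coordinates from `k` on vanish at singular vectors.
  have hj : j.val < k := by
    by_contra! h
    have := hy.1 j h
    rw [Fin.insertNth_apply_same] at this
    exact one_ne_zero this
  let p : {i : Fin m // i.succ.val < k} → ℂ := fun i => y i
  have hlt : ∀ i : {i : Fin m // i.succ.val < k}, (j.succAbove i).val < k := fun i =>
    (succAbove_val_lt_iff hj i.1).2 i.2
  have hM : monomialValue β k (j.insertNth (α := fun _ => ℂ) 1 y) =
      ∏ i : {i : Fin m // i.succ.val < k}, p i ^ β (j.succAbove i) := by
    rw [monomialValue, prod_lt_eq_mul_prod_succAbove hj]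
    simp [p]
  have hp : ∀ i, p i ≠ 0 := fun i => by
    have := (hy.2 _ (hlt i)).1
    rwa [Fin.insertNth_apply_succAbove] at this
  have h₀ : (d : ℂ) + a * ((β j * w j : ℕ) : ℂ) *
      ∏ i : {i : Fin m // i.succ.val < k}, p i ^ β (j.succAbove i) = 0 := by
    have := (hy.2 j hj).2
    rw [hM, Fin.insertNth_apply_same, one_pow, mul_one] at this
    push_cast
    exact this
  have h : ∀ i : {i : Fin m // i.succ.val < k}, (d : ℂ) * p i ^ (d / w (j.succAbove i)) +
      a * (β (j.succAbove i) * w (j.succAbove i)) *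
      ∏ i : {i : Fin m // i.succ.val < k}, p i ^ β (j.succAbove i) = 0 := fun i => by
    have := (hy.2 _ (hlt i)).2
    rwa [hM, Fin.insertNth_apply_succAbove] at this
  have hω : ∀ i : {i : Fin m // i.succ.val < k},
      d / w (j.succAbove i) * w (j.succAbove i) = d := fun i => Nat.div_mul_cancel (hwd _)
  have hsum : ∑ i : {i : Fin m // i.succ.val < k}, β (j.succAbove i) * w (j.succAbove i) +
      β j * w j = d := by
    -- The splitting of products is used for sums by way of `Multiplicative`.
    have := prod_lt_eq_mul_prod_succAbove hj fun i => Multiplicative.ofAdd (β i * w i)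
    rw [← ofAdd_sum, ← ofAdd_sum, ← ofAdd_add] at this
    rw [hβd, add_comm]
    exact (Multiplicative.ofAdd.injective this).symm
  have hB : β j * w j ≠ 0 := mul_ne_zero (hβ j hj) (hw j).ne'
  have hd0 : d ≠ 0 := (pos_of_sum_eq hw hd j).ne'
  have hy0 : ∀ i : Fin m, ¬ i.succ.val < k → y i = 0 := fun i hi => by
    have := hy.1 (j.succAbove i) (by rw [succAbove_eq_succ hj i hi]; exact not_lt.1 hi)
    rwa [Fin.insertNth_apply_succAbove] at this
  have hdet := isUnit_det_hessian_chartPolynomial (a := a) hp hω (fun i => hβ _ (hlt i)) hsum hB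
    h₀ h
  have hcrit := eval_pderiv_chartPolynomial_eq_zero (a := a) hp hω hd0 h
  have hzero := eval_chartPolynomial_eq_zero hsum hB h₀ h
  rw [chartEquation_familyPolynomial hj, normalForm_eq, prod_le_eq_prod_ite hk]
  exact ⟨hasLocalEquation_rename_add (fun i : Fin m => i.succ.val < k) _
      (fun i => d / w i.succ) y hy0 hzero hcrit hdet,
    milnorNumber_rename_add (fun i : Fin m => i.succ.val < k) _ (fun i => d / w i.succ) y
      (fun i _ => (div_pos_of_dvd hw hwd hd _).ne') hy0 hcrit hdet⟩

/-- Scaling by the inverse of a `w 0`-th root of the nonzero coordinate `v 0` makes that coordinate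
`1`. -/
theorem exists_orbifoldChart_zero_eq (hw : ∀ i, 0 < w i) (hk : 1 ≤ k)
    {v : {v : Fin (m + 1) → ℂ // v ≠ 0}} (hv : IsSingularVector w β k d a v.1) :
    ∃ y, orbifoldChart w 0 y = WeightedProjectiveSpace.mk w v := by
  have hv0 : v.1 0 ≠ 0 := (hv.2 0 hk).1
  obtain ⟨t, ht⟩ := IsAlgClosed.exists_pow_nat_eq (v.1 0) (hw 0)
  have ht0 : t ≠ 0 := by
    rintro rfl
    rw [zero_pow (hw 0).ne'] at ht
    exact hv0 ht.symm
  refine ⟨fun i => v.1 i.succ / t ^ w i.succ, Quotient.sound ⟨Units.mk0 t ht0, fun i => ?_⟩⟩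
  refine Fin.cases ?_ (fun i => ?_) i
  · simp [ht]
  · simp only [Fin.insertNth_zero, Fin.cons_succ, Units.val_mk0, cast_eq]
    rw [mul_div_cancel₀ _ (pow_ne_zero _ ht0)]

end Charts

end FermatFamily

end

/-! ### The theorem -/

theorem mainTheorem1 (m k d γ : ℕ) (w β : Fin (m + 1) → ℕ)
    (hw : ∀ i, 0 < w i) (hwd : ∀ i, w i ∣ d)
    (hd : d = ∑ i, w i) (hgcd : Finset.univ.gcd w = 1)
    (hk : 1 ≤ k) (hkn : k ≤ m + 1)
    (hβ : ∀ i : Fin (m + 1), i.val < k → β i ≠ 0)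
    (hβd : d = ∑ i : Fin (m + 1) with i.val < k, β i * w i)
    (hγ : γ = (Finset.univ.filter fun i : Fin (m + 1) => i.val < k).gcd fun i => β i * w i) :
    FermatFamily.discriminant w β k d =
        {a : ℂ | a ^ (d / γ) + (-1) ^ (d / γ - 1) *
          ((d : ℂ) ^ (d / γ) /
            ∏ i : Fin (m + 1) with i.val < k,
              ((β i : ℂ) * (w i : ℂ)) ^ (β i * w i / γ)) = 0} ∧
      (FermatFamily.discriminant w β k d).ncard = d / γ ∧
      ∀ a ∈ FermatFamily.discriminant w β k d,
        (FermatFamily.singularPoints w (FermatFamily.familyPolynomial w β k d a)).Finite ∧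
        ((FermatFamily.singularPoints w
            (FermatFamily.familyPolynomial w β k d a)).ncard : ℚ) =
          (((Finset.univ.filter fun i : Fin (m + 1) => i.val < k).gcd w : ℕ) : ℚ) /
              (∏ i : Fin (m + 1) with i.val < k, (w i : ℚ)) *
            (d : ℚ) ^ ((k : ℤ) - 2) * (γ : ℚ) ∧
        ∀ p ∈ FermatFamily.singularPoints w (FermatFamily.familyPolynomial w β k d a),
          (∃ y, FermatFamily.orbifoldChart w 0 y = p) ∧
          ∀ (j : Fin (m + 1)) (y : Fin m → ℂ), FermatFamily.orbifoldChart w j y = p →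
            FermatFamily.HasLocalEquation
              (FermatFamily.chartEquation (FermatFamily.familyPolynomial w β k d a) j) y
              (FermatFamily.normalForm w k d) ∧
            FermatFamily.milnorNumber
              (FermatFamily.chartEquation (FermatFamily.familyPolynomial w β k d a) j) y =
              ((∏ i : Fin (m + 1) with k ≤ i.val, (d / w i - 1) : ℕ) : ℕ∞) := by
  have hn : 0 < m + 1 := Nat.succ_pos m
  have hd0 : d ≠ 0 := (FermatFamily.pos_of_sum_eq hw hd 0).ne'
  obtain ⟨h1, h2⟩ := FermatFamily.discriminant_eq hn hw hwd hd hk hβ hβd hγ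
  refine ⟨h1, h2, fun a ha => ?_⟩
  obtain ⟨v₀, hv₀⟩ := (FermatFamily.mem_discriminant_iff hn hw hwd hd hk hβ hβd).1 ha
  obtain ⟨hfin, hcard⟩ := FermatFamily.finite_singularPoints_and_ncard hn hw hwd hd hk hβ hβd hv₀
  have hmem := fun v => FermatFamily.mk_mem_singularPoints_iff (a := a) hw hwd hd hk hβ hβd v
  refine ⟨hfin, ?_, fun p hp => ⟨?_, ?_⟩⟩
  · have hs : ∀ x : Fin (m + 1),
        x ∈ Finset.univ.filter (fun i : Fin (m + 1) => i.val < k) ↔ x.val < k := by simp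
    have hb : ∑ i : {i : Fin (m + 1) // i.val < k}, β i * w i = d := by
      rw [hβd, Finset.sum_subtype _ hs]
    have hg : Finset.univ.gcd (fun i : {i : Fin (m + 1) // i.val < k} => w i) ∣ d := by
      rw [← hb]
      exact Finset.dvd_sum fun i hi => (Finset.gcd_dvd hi).mul_left _
    have hcardι : Fintype.card {i : Fin (m + 1) // i.val < k} = k := by
      rw [Fintype.card_subtype, Fin.card_filter_val_lt, min_eq_right hkn]
    rw [hcard, FermatFamily.relIndex_mul_eq _ _ _ d hd0 _ hg hb, hcardι, hγ,
      FermatFamily.gcd_filter_eq_gcd_subtype, FermatFamily.gcd_filter_eq_gcd_subtype,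
      Finset.prod_subtype _ hs]
  · obtain ⟨v, rfl⟩ := Quotient.exists_rep p
    exact FermatFamily.exists_orbifoldChart_zero_eq hw hk ((hmem v).1 hp)
  · rintro j y rfl
    exact ((hmem _).1 hp).hasLocalEquation_and_milnorNumber hw hwd hd hk hβ hβd
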